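/- Let $m_s,m_b,m_a,\mathcal I_a,\mathcal I_b,L,d_G,g,T_{max}>0$ and put $M_t=m_s+m_b+m_a$, $M_a=\frac{m_bd_G}{L}+m_a$, $\mathcal I_0=\frac{m_bd_G^2+\mathcal I_b}{L}+m_aL$. Consider the UAV–UGV–object system with coordinates $x,\alpha,\beta$ and relative angle $\theta=\beta-\alpha$, $$M_t\ddot x-M_aL(\ddot\alpha\sin\alpha+\dot\alpha^2\cos\alpha)=u_{ff},\quad -M_aL(\ddot x\sin\alpha-g\cos\alpha)+\mathcal I_0L\ddot\alpha=u_n\sin\theta,\quad \mathcal I_a\ddot\beta=u_2 .$$ Let $k_{p,x}>k_{p,\alpha}>0$, $k_{v,x}>k_{v,\alpha}>0$, $\epsilon>0$, $\gamma=\frac{\pi}{2\arctan(\epsilon T_{max}L)}$, and for $\lambda>0$ let $\sigma_\lambda(s)=\operatorname{sign}(s)\min(|s|,\lambda)$ and $\sigma_{0,\lambda}(s)=\max\{\sigma_\lambda(s),0\}$. Given references $x_d,\alpha_d$ and gains $k_{p,\beta},k_{v,\beta}$, use the control laws $$u_{ff}=k_{p,x}(x_d-x)-k_{v,x}\dot x,\qquad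 u_2=-k_{p,\beta}(\beta-\beta_d)-k_{v,\beta}\dot\beta,\qquad \beta_d=\alpha+\theta_d,$$ $$\theta_d=\sigma_{\pi/2}(\gamma\arctan(\epsilon f_t)),\qquad f_t=k_{p,\alpha}(\alpha_d-\alpha)-k_{v,\alpha}\dot\alpha+M_aLg\cos\alpha,$$ and, in place of the thrust law (old) $u_n=f_t/\sin\theta_d$ (with its limit value $1/(\gamma\epsilon)$ at $f_t=0$), the thrust law (new) $u_n=\sigma_{0,T_{max}L}(f_t/\sin\theta)$ (with $u_n=0$ where $\sin\theta=0$; the choice does not affect $u_n\sin\theta$). Let $(\alpha_{min},\alpha_{max})=(0,\pi)$ if $T_{max}\ge M_ag$, and $\alpha_{min}=\arccos\frac{T_{max}}{M_ag}$, $\alpha_{max}=\arccos\frac{-T_{max}}{M_ag}$ otherwise. 1. For every $x_d\in\mathbb R$ and $\alpha_d\in(\alpha_{min},\alpha_{max})$, let $\bar\beta=\alpha_d+\theta_d|_{f_t=M_aLg\cos\alpha_d}$ be the resulting steady-state value of $\beta_d$. Under the new law the equilibrium $(x,\alpha,\beta)=(x_d,\alpha_d,\bar\beta)$, with zero velocities,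 is (locally) asymptotically stable for suitably large $k_{p,\beta}$ and $k_{v,\beta}$, that is: there is $K_v>0$ such that for every $k_{v,\beta}>K_v$ there is $K_p>0$ such that this holds for all $k_{p,\beta}>K_p$. If $\alpha_d\neq\pi/2$, it holds for all $k_{p,\beta},k_{v,\beta}>0$. 2. The new law is equivalent to the old one with a feed-forward block that shrinks the effective attitude error: there is a function $(f_t,\tilde\theta)\mapsto\tilde\theta_f$ such that, whenever $|f_t|\le T_{max}L$, for every $\tilde\theta\in\mathbb R$ and $\theta=\theta_d+\tilde\theta$, $$|\tilde\theta_f|\le|\tilde\theta|,\qquad \frac{f_t}{\sin\theta_d}\,\sin(\theta_d+\tilde\theta_f)=\sigma_{0,T_{max}L}\Big(\frac{f_t}{\sin\theta}\Big)\sin\theta ,$$ where $f_t/\sin\theta_d$ is read as $1/(\gamma\epsilon)$ at $f_t=0$. Hence, at every state with $|f_t|\le T_{max}L$, the closed loop under the new law has the same equations as the closed loop in which $u_n\sin\theta$ is replaced by $\frac{f_t}{\sin\theta_d}\sin(\theta_d+\tilde\theta_f)$ with $\tilde\theta=\theta-\theta_d$. For $\alpha_d\in(\alpha_{min},\alpha_{max})$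 these states include a neighbourhood of the equilibrium. -/

import Mathlib

open Set Filter Topology

noncomputable section

namespace UAVUGV

/-- Physical constants of a UAV and a UGV manipulating an object in a vertical plane. -/
structure Plant where
  /-- mass of the UGV -/
  ms : ℝ
  /-- mass of the object -/
  mb : ℝ
  /-- mass of the UAV -/
  ma : ℝ
  /-- moment of inertia of the UAV -/
  Ia : ℝ
  /-- moment of inertia of the object -/
  Ib : ℝ
  /-- length of the object -/
  L : ℝ
  /-- distance of the centre of mass of the object from the UGV -/
  dG : ℝ
  /-- gravity acceleration -/
  g : ℝ
  /-- maximal total thrust of the UAV -/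
  Tmax : ℝ
  ms_pos : 0 < ms
  mb_pos : 0 < mb
  ma_pos : 0 < ma
  Ia_pos : 0 < Ia
  Ib_pos : 0 < Ib
  L_pos : 0 < L
  dG_pos : 0 < dG
  g_pos : 0 < g
  Tmax_pos : 0 < Tmax

/-- Gains of the UGV loop and of the outer (object inclination) loop, and the parameter `ε` of
the attitude mapping. -/
structure OuterGains where
  kpx : ℝ
  kvx : ℝ
  kpα : ℝ
  kvα : ℝ
  ε : ℝ
  kpα_pos : 0 < kpα
  kvα_pos : 0 < kvα
  kpα_lt_kpx : kpα < kpx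
  kvα_lt_kvx : kvα < kvx
  ε_pos : 0 < ε

namespace Plant

variable (P : Plant)

/-- total mass -/
def Mt : ℝ := P.ms + P.mb + P.ma

/-- apparent mass of the UAV and the object -/
def Ma : ℝ := P.mb * P.dG / P.L + P.ma

/-- moment of inertia of the system divided by `L` -/
def I₀ : ℝ := (P.mb * P.dG ^ 2 + P.Ib) / P.L + P.ma * P.L

/-- smallest attainable equilibrium inclination -/
def αmin : ℝ := if P.Ma * P.g ≤ P.Tmax then 0 else Real.arccos (P.Tmax / (P.Ma * P.g))

/-- largest attainable equilibrium inclination -/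
def αmax : ℝ := if P.Ma * P.g ≤ P.Tmax then Real.pi else Real.arccos (-P.Tmax / (P.Ma * P.g))

end Plant

/-- The saturation `σ_lam(s) = sign(s) min(|s|, lam)`. -/
def sat (lam s : ℝ) : ℝ := Real.sign s * min |s| lam

/-- The positive saturation `σ_{0,lam}(s) = max{σ_lam(s), 0}`. -/
def satPos (lam s : ℝ) : ℝ := max (sat lam s) 0

/-- The state `(x, ẋ, α, α̇, β, β̇)`. All norms on this space are equivalent, so the sup norm it
carries gives the usual notion of stability. -/
abbrev State : Type := Fin 6 → ℝ

section Control

variable (P : Plant) (G : OuterGains)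

/-- `γ = π / (2 arctan(ε Tmax L))`. -/
def gam : ℝ := Real.pi / (2 * Real.arctan (G.ε * (P.Tmax * P.L)))

/-- The desired relative attitude `θ_d = σ_{π/2}(γ arctan(ε f_t))`, as a function of `f_t`. -/
def thetaD (f : ℝ) : ℝ := sat (Real.pi / 2) (gam P G * Real.arctan (G.ε * f))

/-- The first thrust law `u_n = f_t / sin θ_d`, with its limit value `1/(γ ε)` at `f_t = 0`. -/
def thrustOld (f : ℝ) : ℝ :=
  if f = 0 then 1 / (gam P G * G.ε) else f / Real.sin (thetaD P G f)

/-- The new thrust law `u_n = σ_{0, Tmax L}(f_t / sin θ)`. Where `sin θ = 0` the value is `0`; the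
choice is immaterial since `u_n` enters the equations of motion only through `u_n sin θ`. -/
def thrustNew (f θ : ℝ) : ℝ := satPos (P.Tmax * P.L) (f / Real.sin θ)

/-- The tangential force `f_t`: a PD law with gravity compensation. -/
def tangentialForce (αd : ℝ) (z : State) : ℝ :=
  G.kpα * (αd - z 2) - G.kvα * z 3 + P.Ma * P.L * P.g * Real.cos (z 2)

/-- The actual relative angle `θ = β - α`. -/
def relAngle (z : State) : ℝ := z 4 - z 2

/-- The desired relative attitude at a state. -/
def relAngleD (αd : ℝ) (z : State) : ℝ := thetaD P G (tangentialForce P G αd z)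

/-- The attitude error `θ - θ_d = β - β_d`, where `β_d = α + θ_d`. -/
def attError (αd : ℝ) (z : State) : ℝ := relAngle z - relAngleD P G αd z

/-- The UGV law `u_ff = k_{p,x} (x_d - x) - k_{v,x} ẋ`. -/
def uff (xd : ℝ) (z : State) : ℝ := G.kpx * (xd - z 0) - G.kvx * z 1

/-- The UAV attitude law `u_2 = -k_{p,β} (β - β_d) - k_{v,β} β̇`. -/
def u₂ (kpβ kvβ αd : ℝ) (z : State) : ℝ := -kpβ * attError P G αd z - kvβ * z 5

/-- The equations of motion, with the laws `uff` and `u₂` in place, and with `F z` as the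
right-hand side `u_n sin θ` of the second one. `ClosedLoop … z w` says that `w` is an admissible
time derivative of the state at the state `z`. -/
def ClosedLoop (kpβ kvβ xd αd : ℝ) (F : State → ℝ) (z w : State) : Prop :=
  w 0 = z 1 ∧ w 2 = z 3 ∧ w 4 = z 5 ∧
  P.Mt * w 1 - P.Ma * P.L * (w 3 * Real.sin (z 2) + z 3 ^ 2 * Real.cos (z 2)) = uff G xd z ∧
  -(P.Ma * P.L) * (w 1 * Real.sin (z 2) - P.g * Real.cos (z 2)) + P.I₀ * P.L * w 3 = F z ∧
  P.Ia * w 5 = u₂ P G kpβ kvβ αd z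

/-- `u_n sin θ` under the new thrust law. -/
def forceNew (αd : ℝ) (z : State) : ℝ :=
  thrustNew P (tangentialForce P G αd z) (relAngle z) * Real.sin (relAngle z)

/-- `u_n sin (θ_d + e_f)` under the first thrust law, when a feed-forward block `φ` replaces the
attitude error `e = θ - θ_d` by `e_f = φ f_t e`. -/
def forceOldFF (φ : ℝ → ℝ → ℝ) (αd : ℝ) (z : State) : ℝ :=
  thrustOld P G (tangentialForce P G αd z) *
    Real.sin (relAngleD P G αd z + φ (tangentialForce P G αd z) (attError P G αd z))

/-- The equilibrium `(x_d, 0, α_d, 0, β_d, 0)`, where `β_d = α_d + θ_d` is the steady-state desired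
attitude, `θ_d` being evaluated at `f_t = M_a L g cos α_d`. -/
def equilibrium (xd αd : ℝ) : State :=
  ![xd, 0, αd, 0, αd + thetaD P G (P.Ma * P.L * P.g * Real.cos αd), 0]

end Control

section Stability

variable {E : Type*} [NormedAddCommGroup E] [NormedSpace ℝ E]

/-- `z` solves the (implicit, autonomous) differential equation `D z ż` on the time set `I`. -/
def IsSolutionOn (D : E → E → Prop) (I : Set ℝ) (z : ℝ → E) : Prop :=
  ∀ t ∈ I, ∃ w, HasDerivWithinAt z w I t ∧ D (z t) w

/-- Asymptotic stability in the sense of Lyapunov: `p` is an equilibrium, solutions that start near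
it exist for all future times, stay near it and converge to it. -/
structure AsymptoticallyStable (D : E → E → Prop) (p : E) : Prop where
  equilibrium : D p 0
  exists_solution : ∃ δ > 0, ∀ a, ‖a - p‖ < δ → ∃ z : ℝ → E, z 0 = a ∧ IsSolutionOn D (Ici 0) z
  stable : ∀ ε > 0, ∃ δ > 0, ∀ (T : ℝ) (z : ℝ → E), IsSolutionOn D (Icc 0 T) z →
    ‖z 0 - p‖ < δ → ∀ t ∈ Icc 0 T, ‖z t - p‖ < ε
  attractive : ∃ δ > 0, ∀ z : ℝ → E, IsSolutionOn D (Ici 0) z →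
    ‖z 0 - p‖ < δ → Tendsto z atTop (𝓝 p)

end Stability

end UAVUGV

end

namespace UAVUGV

open scoped NNReal

section GlobalSolutions

variable {E : Type*} [NormedAddCommGroup E] [NormedSpace ℝ E] [CompleteSpace E]

theorem exists_solution_Icc {g : E → E} {K M : ℝ≥0} (hg : LipschitzWith K g)
    (hM : ∀ x, ‖g x‖ ≤ M) (a : E) {T : ℝ} (hT : 0 ≤ T) :
    ∃ z : ℝ → E, z 0 = a ∧ ∀ t ∈ Icc (0 : ℝ) T, HasDerivWithinAt z (g (z t)) (Icc 0 T) t := by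
  have h0 : (0 : ℝ) ∈ Icc (0 : ℝ) T := ⟨le_rfl, hT⟩
  have hpl : IsPicardLindelof (fun _ => g) (⟨0, h0⟩ : Icc (0 : ℝ) T) a (M * ⟨T, hT⟩) 0 M K :=
    { lipschitzOnWith := fun _ _ => hg.lipschitzOnWith
      continuousOn := fun _ _ => continuousOn_const
      norm_le := fun _ _ x _ => hM x
      mul_max_le := by simp [hT]; rfl }
  obtain ⟨z, hz0, hz⟩ := hpl.exists_eq_forall_mem_Icc_hasDerivWithinAt₀
  exact ⟨z, hz0, hz⟩

/-- A bounded Lipschitz vector field has solutions for all positive times. -/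
theorem exists_solution_Ici {g : E → E} {K M : ℝ≥0} (hg : LipschitzWith K g)
    (hM : ∀ x, ‖g x‖ ≤ M) (a : E) :
    ∃ z : ℝ → E, z 0 = a ∧ ∀ t ∈ Ici (0 : ℝ), HasDerivWithinAt z (g (z t)) (Ici 0) t := by
  choose y hy0 hy using fun n : ℕ => exists_solution_Icc hg hM a (T := (n : ℝ) + 1) (by positivity)
  have key : ∀ n m : ℕ, n ≤ m → EqOn (y n) (y m) (Icc 0 ((n : ℝ) + 1)) := by
    intro n m hnm
    have hnm' : (n : ℝ) ≤ m := by exact_mod_cast hnm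
    have hsub : Icc (0 : ℝ) ((n : ℝ) + 1) ⊆ Icc 0 ((m : ℝ) + 1) := Icc_subset_Icc_right (by linarith)
    have hd : ∀ k : ℕ, (n : ℝ) ≤ k → ∀ t ∈ Ico (0 : ℝ) ((n : ℝ) + 1),
        HasDerivWithinAt (y k) (g (y k t)) (Ici t) t := by
      intro k hk t ht
      have hk' : t < (k : ℝ) + 1 := by linarith [ht.2]
      exact (hy k t ⟨ht.1, hk'.le⟩).mono_of_mem_nhdsWithin
        (mem_of_superset (Icc_mem_nhdsGE hk') (Icc_subset_Icc_left ht.1))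
    refine ODE_solution_unique_of_mem_Icc_right (v := fun _ => g) (s := fun _ => univ) (K := K)
      (fun _ _ => hg.lipschitzOnWith) (fun t ht => (hy n t ht).continuousWithinAt)
      (hd n le_rfl) (fun _ _ => mem_univ _)
      (fun t ht => ((hy m t (hsub ht)).mono hsub).continuousWithinAt) (hd m hnm')
      (fun _ _ => mem_univ _) (by rw [hy0, hy0])
  have heq : ∀ (n : ℕ), ∀ s ∈ Icc (0 : ℝ) ((n : ℝ) + 1), y ⌊s⌋₊ s = y (n + 1) s := by
    intro n s hs
    refine key ⌊s⌋₊ (n + 1) ?_ ⟨hs.1, (Nat.lt_floor_add_one s).le⟩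
    have : (⌊s⌋₊ : ℝ) ≤ ((n + 1 : ℕ) : ℝ) := by
      push_cast
      exact (Nat.floor_le hs.1).trans hs.2
    exact_mod_cast this
  have hder : ∀ (n : ℕ), ∀ t ∈ Ico (0 : ℝ) ((n : ℝ) + 1),
      HasDerivWithinAt (fun s => y ⌊s⌋₊ s) (g (y ⌊t⌋₊ t)) (Ici 0) t := by
    intro n t ht
    have hmem : Icc (0 : ℝ) ((n : ℝ) + 1) ∈ 𝓝[Ici 0] t := by
      filter_upwards [self_mem_nhdsWithin, mem_nhdsWithin_of_mem_nhds (Iio_mem_nhds ht.2)]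
        with s h1 h2
      exact ⟨h1, le_of_lt h2⟩
    have hsub : Icc (0 : ℝ) ((n : ℝ) + 1) ⊆ Icc 0 (((n + 1 : ℕ) : ℝ) + 1) :=
      Icc_subset_Icc_right (by push_cast; linarith)
    have hd := (hy (n + 1) t (hsub ⟨ht.1, ht.2.le⟩)).mono_of_mem_nhdsWithin
      (mem_of_superset hmem hsub)
    have het := heq n t ⟨ht.1, ht.2.le⟩
    rw [het]
    refine hd.congr_of_eventuallyEq ?_ het
    filter_upwards [hmem] with s hs using heq n s hs
  exact ⟨fun t => y ⌊t⌋₊ t, hy0 _, fun t ht => hder ⌊t⌋₊ t ⟨ht, Nat.lt_floor_add_one t⟩⟩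

end GlobalSolutions

section Lyapunov

variable {E : Type*} [NormedAddCommGroup E] [NormedSpace ℝ E]

/-- A curve that starts in a small ball, and along which a function comparable to the squared
distance to the centre does not increase, stays in a given ball. -/
theorem norm_sub_lt_of_lyapunov {p : E} {V : E → ℝ} {V' : E → E → ℝ} {r c₁ c₂ ε δ T : ℝ}
    (hVc : Continuous V)
    (hV : ∀ (z : ℝ → E) (I : Set ℝ) (t : ℝ) (w : E), HasDerivWithinAt z w I t →
      HasDerivWithinAt (fun s => V (z s)) (V' (z t) w) I t)
    (hlo : ∀ z, ‖z - p‖ < r → c₁ * ‖z - p‖ ^ 2 ≤ V z)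
    (hhi : ∀ z, ‖z - p‖ < r → V z ≤ c₂ * ‖z - p‖ ^ 2)
    (hc₂ : 0 < c₂) (hεr : ε < r) (hδε : δ ≤ ε) (hδ : c₂ * δ ^ 2 < c₁ * ε ^ 2)
    {z : ℝ → E} (hzc : ContinuousOn z (Icc 0 T))
    (hz : ∀ t ∈ Icc 0 T, ‖z t - p‖ < r →
      ∃ w, HasDerivWithinAt z w (Icc 0 T) t ∧ V' (z t) w ≤ 0)
    (h0 : ‖z 0 - p‖ < δ) : ∀ t ∈ Icc 0 T, ‖z t - p‖ < ε := by
  by_contra! hcon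
  obtain ⟨t₀, ht₀, hbad⟩ := hcon
  have hnc : ContinuousOn (fun t => ‖z t - p‖) (Icc 0 T) := (hzc.sub continuousOn_const).norm
  have hclosed : IsClosed (Icc 0 T ∩ (fun t => ‖z t - p‖) ⁻¹' Ici ε) :=
    hnc.preimage_isClosed_of_isClosed isClosed_Icc isClosed_Ici
  obtain ⟨t₁, ⟨ht₁, hge⟩, hleast⟩ :=
    (isCompact_Icc.of_isClosed_subset hclosed inter_subset_left).exists_isLeast ⟨t₀, ht₀, hbad⟩
  have hge : ε ≤ ‖z t₁ - p‖ := hge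
  have hsub : Icc 0 t₁ ⊆ Icc 0 T := Icc_subset_Icc_right ht₁.2
  have heq : ‖z t₁ - p‖ = ε := by
    obtain ⟨s, hs, hse⟩ := intermediate_value_Icc ht₁.1 (hnc.mono hsub)
      (⟨(h0.trans_le hδε).le, hge⟩ : ε ∈ Icc ‖z 0 - p‖ ‖z t₁ - p‖)
    have hs1 : t₁ ≤ s := hleast ⟨hsub hs, ge_of_eq hse⟩
    rw [le_antisymm hs1 hs.2]
    exact hse
  have hin : ∀ s ∈ Icc 0 t₁, ‖z s - p‖ < r := by
    intro s hs
    by_contra! hsr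
    have hs1 : t₁ ≤ s := hleast ⟨hsub hs, hεr.le.trans hsr⟩
    rw [← le_antisymm hs1 hs.2, heq] at hsr
    linarith
  choose! w hw hneg using fun s (hs : s ∈ Icc 0 t₁) => hz s (hsub hs) (hin s hs)
  have hanti : AntitoneOn (fun s => V (z s)) (Icc 0 t₁) :=
    antitoneOn_of_hasDerivWithinAt_nonpos (convex_Icc 0 t₁)
      (hVc.comp_continuousOn (hzc.mono hsub))
      (fun s hs => hV z _ s _ ((hw s (interior_subset hs)).mono (interior_subset.trans hsub)))
      (fun s hs => hneg s (interior_subset hs))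
  have h1 : V (z t₁) ≤ V (z 0) := hanti ⟨le_rfl, ht₁.1⟩ ⟨ht₁.1, le_rfl⟩ ht₁.1
  have h2 := hlo _ (hin t₁ ⟨ht₁.1, le_rfl⟩)
  have h3 := hhi _ (hin 0 ⟨le_rfl, ht₁.1⟩)
  have h4 : c₂ * ‖z 0 - p‖ ^ 2 ≤ c₂ * δ ^ 2 := by gcongr
  rw [heq] at h2
  linarith

theorem tendsto_of_lyapunov {p : E} {V : E → ℝ} {V' : E → E → ℝ} {r c₁ c₂ c₃ : ℝ}
    (hV : ∀ (z : ℝ → E) (I : Set ℝ) (t : ℝ) (w : E), HasDerivWithinAt z w I t →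
      HasDerivWithinAt (fun s => V (z s)) (V' (z t) w) I t)
    (hlo : ∀ z, ‖z - p‖ < r → c₁ * ‖z - p‖ ^ 2 ≤ V z)
    (hhi : ∀ z, ‖z - p‖ < r → V z ≤ c₂ * ‖z - p‖ ^ 2)
    (hc₁ : 0 < c₁) (hc₂ : 0 < c₂) (hc₃ : 0 < c₃) {z : ℝ → E}
    (hzr : ∀ t ∈ Ici (0 : ℝ), ‖z t - p‖ < r)
    (hz : ∀ t ∈ Ici (0 : ℝ),
      ∃ w, HasDerivWithinAt z w (Ici 0) t ∧ V' (z t) w ≤ -c₃ * ‖z t - p‖ ^ 2) :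
    Tendsto z atTop (𝓝 p) := by
  set k := c₃ / c₂ with hk
  have hk0 : 0 < k := by positivity
  choose! w hw hdec using hz
  have hder : ∀ t ∈ Ici (0 : ℝ), HasDerivWithinAt (fun s => V (z s) * Real.exp (k * s))
      (V' (z t) (w t) * Real.exp (k * t) + V (z t) * (Real.exp (k * t) * k)) (Ici 0) t := by
    intro t ht
    have h2 : HasDerivAt (fun s : ℝ => Real.exp (k * s)) (Real.exp (k * t) * k) t := by
      simpa using ((hasDerivAt_id t).const_mul k).exp
    exact (hV z _ t _ (hw t ht)).mul h2.hasDerivWithinAt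
  have hanti : AntitoneOn (fun s => V (z s) * Real.exp (k * s)) (Ici 0) := by
    refine antitoneOn_of_hasDerivWithinAt_nonpos (convex_Ici 0)
      (fun t ht => (hder t ht).continuousWithinAt)
      (fun t ht => (hder t (interior_subset ht)).mono interior_subset) fun t ht => ?_
    have ht := interior_subset ht
    have h1 : k * V (z t) ≤ c₃ * ‖z t - p‖ ^ 2 := by
      calc k * V (z t) ≤ k * (c₂ * ‖z t - p‖ ^ 2) := by gcongr; exact hhi _ (hzr t ht)
        _ = c₃ * ‖z t - p‖ ^ 2 := by rw [hk]; field_simp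
    have h2 := hdec t ht
    have : V' (z t) (w t) * Real.exp (k * t) + V (z t) * (Real.exp (k * t) * k)
        = (V' (z t) (w t) + k * V (z t)) * Real.exp (k * t) := by ring
    rw [this]
    exact mul_nonpos_of_nonpos_of_nonneg (by linarith) (Real.exp_pos _).le
  have hb : ∀ t ∈ Ici (0 : ℝ), ‖z t - p‖ ^ 2 ≤ V (z 0) / c₁ * Real.exp (-(k * t)) := by
    intro t ht
    have h1 := hanti (mem_Ici.2 le_rfl) ht ht
    simp only [mul_zero, Real.exp_zero, mul_one] at h1
    have h2 := hlo _ (hzr t ht)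
    rw [Real.exp_neg, ← div_eq_mul_inv, le_div_iff₀ (Real.exp_pos _), le_div_iff₀ hc₁]
    calc ‖z t - p‖ ^ 2 * Real.exp (k * t) * c₁ = c₁ * ‖z t - p‖ ^ 2 * Real.exp (k * t) := by ring
      _ ≤ V (z t) * Real.exp (k * t) := by gcongr
      _ ≤ V (z 0) := h1
  rw [tendsto_iff_norm_sub_tendsto_zero]
  have hlim : Tendsto (fun t : ℝ => V (z 0) / c₁ * Real.exp (-(k * t))) atTop (𝓝 0) := by
    have := (Real.tendsto_exp_neg_atTop_nhds_zero.comp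
      (tendsto_id.const_mul_atTop hk0)).const_mul (V (z 0) / c₁)
    simpa using this
  have hsq : Tendsto (fun t : ℝ => ‖z t - p‖ ^ 2) atTop (𝓝 0) :=
    squeeze_zero' (Eventually.of_forall fun t => by positivity)
      ((eventually_ge_atTop 0).mono fun t ht => hb t ht) hlim
  have := hsq.sqrt
  simpa [Real.sqrt_sq (norm_nonneg _)] using this

end Lyapunov

section Retraction

variable {ι : Type*} [Fintype ι]

/-- Coordinatewise clamping to the box of radius `r` centred at `p`. -/
def boxClamp (p : ι → ℝ) (r : ℝ) (z : ι → ℝ) : ι → ℝ :=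
  fun i => max (p i - r) (min (p i + r) (z i))

theorem lipschitzWith_boxClamp (p : ι → ℝ) (r : ℝ) : LipschitzWith 1 (boxClamp p r) := by
  refine LipschitzWith.of_dist_le_mul fun x y => ?_
  simp only [NNReal.coe_one, one_mul]
  refine (dist_pi_le_iff dist_nonneg).2 fun i => ?_
  refine le_trans ?_ (dist_le_pi_dist x y i)
  simp only [boxClamp, Real.dist_eq]
  refine (abs_max_sub_max_le_max _ _ _ _).trans ?_
  rw [sub_self, abs_zero, max_eq_right (abs_nonneg _)]
  simpa using abs_min_sub_min_le_max (p i + r) (x i) (p i + r) (y i)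

theorem norm_boxClamp_sub_le (p : ι → ℝ) {r : ℝ} (hr : 0 ≤ r) (z : ι → ℝ) :
    ‖boxClamp p r z - p‖ ≤ r := by
  refine (pi_norm_le_iff_of_nonneg hr).2 fun i => ?_
  simp only [boxClamp, Pi.sub_apply, Real.norm_eq_abs, abs_le]
  constructor
  · linarith [le_max_left (p i - r) (min (p i + r) (z i))]
  · have : max (p i - r) (min (p i + r) (z i)) ≤ p i + r :=
      max_le (by linarith) (min_le_left _ _)
    linarith

theorem boxClamp_of_norm_sub_le {p : ι → ℝ} {r : ℝ} {z : ι → ℝ} (h : ‖z - p‖ ≤ r) :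
    boxClamp p r z = z := by
  ext i
  have := (norm_le_pi_norm (z - p) i).trans h
  simp only [Pi.sub_apply, Real.norm_eq_abs, abs_le] at this
  rw [boxClamp, min_eq_right (by linarith), max_eq_right (by linarith)]

end Retraction

/-- Lyapunov's theorem, for a locally Lipschitz vector field and a quadratically bounded strict
Lyapunov function. -/
theorem asymptoticallyStable_of_lyapunov {ι : Type*} [Fintype ι]
    {D : (ι → ℝ) → (ι → ℝ) → Prop} {p : ι → ℝ} {v : (ι → ℝ) → ι → ℝ}
    (hD : ∀ z w, D z w ↔ w = v z) (hv : LocallyLipschitz v) (hp : v p = 0)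
    {V : (ι → ℝ) → ℝ} {V' : (ι → ℝ) → (ι → ℝ) → ℝ} {r c₁ c₂ c₃ : ℝ} (hVc : Continuous V)
    (hV : ∀ (z : ℝ → ι → ℝ) (I : Set ℝ) (t : ℝ) (w : ι → ℝ), HasDerivWithinAt z w I t →
      HasDerivWithinAt (fun s => V (z s)) (V' (z t) w) I t)
    (hr : 0 < r) (hc₁ : 0 < c₁) (hc₂ : 0 < c₂) (hc₃ : 0 < c₃)
    (hlo : ∀ z, ‖z - p‖ < r → c₁ * ‖z - p‖ ^ 2 ≤ V z)
    (hhi : ∀ z, ‖z - p‖ < r → V z ≤ c₂ * ‖z - p‖ ^ 2)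
    (hdec : ∀ z, ‖z - p‖ < r → V' z (v z) ≤ -c₃ * ‖z - p‖ ^ 2) :
    AsymptoticallyStable D p := by
  have hnp : ∀ z, ‖z - p‖ < r → V' z (v z) ≤ 0 := fun z hz =>
    (hdec z hz).trans (by have : 0 ≤ c₃ * ‖z - p‖ ^ 2 := by positivity
                          linarith)
  have hsmall : ∀ ε > 0, ∃ δ > 0, δ ≤ ε ∧ c₂ * δ ^ 2 < c₁ * ε ^ 2 := by
    intro ε hε
    have hcont : Tendsto (fun δ : ℝ => c₂ * δ ^ 2) (𝓝[>] 0) (𝓝 0) := by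
      have : Continuous fun δ : ℝ => c₂ * δ ^ 2 := by fun_prop
      simpa using (this.tendsto 0).mono_left nhdsWithin_le_nhds
    obtain ⟨δ, h1, h2, h3⟩ := ((hcont.eventually (gt_mem_nhds (by positivity : 0 < c₁ * ε ^ 2))).and
      ((eventually_nhdsWithin_of_eventually_nhds (eventually_le_nhds hε)).and
        self_mem_nhdsWithin)).exists
    exact ⟨δ, h3, h2, h1⟩
  have hsol : ∀ {I : Set ℝ} {z : ℝ → ι → ℝ}, IsSolutionOn D I z →
      ∀ t ∈ I, HasDerivWithinAt z (v (z t)) I t := by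
    intro I z hz t ht
    obtain ⟨w, hw, hDw⟩ := hz t ht
    rwa [(hD _ _).1 hDw] at hw
  have htrap : ∀ ε > 0, ∀ r', ε < r' → r' ≤ r → ∃ δ > 0, ∀ (T : ℝ) (z : ℝ → ι → ℝ),
      ContinuousOn z (Icc 0 T) →
      (∀ t ∈ Icc 0 T, ‖z t - p‖ < r' → HasDerivWithinAt z (v (z t)) (Icc 0 T) t) →
      ‖z 0 - p‖ < δ → ∀ t ∈ Icc 0 T, ‖z t - p‖ < ε := by
    intro ε hε r' hεr hr'
    obtain ⟨δ, hδ0, hδε, hδ⟩ := hsmall ε hε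
    exact ⟨δ, hδ0, fun T z hzc hz => norm_sub_lt_of_lyapunov hVc hV
      (fun z hz => hlo z (hz.trans_le hr')) (fun z hz => hhi z (hz.trans_le hr')) hc₂ hεr hδε hδ hzc
      fun t ht htr => ⟨_, hz t ht htr, hnp _ (htr.trans_le hr')⟩⟩
  refine ⟨(hD _ _).2 hp.symm, ?_, ?_, ?_⟩
  · obtain ⟨K, s, hs, hK⟩ := hv p
    obtain ⟨ρ, hρ, hρs⟩ := Metric.mem_nhds_iff.1 hs
    set R := min (ρ / 2) r with hR
    have hR0 : 0 < R := lt_min (by linarith) hr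
    have hcl : ∀ z, boxClamp p R z ∈ s := fun z => hρs (by
      rw [Metric.mem_ball, dist_eq_norm]
      exact (norm_boxClamp_sub_le p hR0.le z).trans_lt ((min_le_left _ _).trans_lt (by linarith)))
    have hps : p ∈ s := mem_of_mem_nhds hs
    have hgL : LipschitzWith (K * 1) (v ∘ boxClamp p R) := by
      rw [← lipschitzOnWith_univ]
      exact hK.comp (lipschitzWith_boxClamp p R).lipschitzOnWith fun z _ => hcl z
    have hgM : ∀ z, ‖(v ∘ boxClamp p R) z‖ ≤ (K * ⟨R, hR0.le⟩ : ℝ≥0) := by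
      intro z
      have := hK.dist_le_mul _ (hcl z) _ hps
      rw [hp, dist_zero_right, dist_eq_norm] at this
      exact this.trans (mul_le_mul_of_nonneg_left (norm_boxClamp_sub_le p hR0.le z) K.2)
    obtain ⟨δ, hδ0, hδ⟩ := htrap (R / 2) (by linarith) R (by linarith) (min_le_right _ _)
    refine ⟨δ, hδ0, fun a ha => ?_⟩
    obtain ⟨z, hz0, hz⟩ := exists_solution_Ici hgL hgM a
    refine ⟨z, hz0, ?_⟩
    have hzR : ∀ t ∈ Ici (0 : ℝ), ‖z t - p‖ < R := by
      intro t ht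
      have hd : ∀ s ∈ Icc 0 t, HasDerivWithinAt z ((v ∘ boxClamp p R) (z s)) (Icc 0 t) s :=
        fun s hs => (hz s hs.1).mono Icc_subset_Ici_self
      refine (hδ t z (fun s hs => (hd s hs).continuousWithinAt) (fun s hs hsR => ?_)
        (by rwa [hz0]) t ⟨ht, le_rfl⟩).trans (by linarith)
      have := hd s hs
      rwa [Function.comp_apply, boxClamp_of_norm_sub_le hsR.le] at this
    intro t ht
    have := hz t ht
    rw [Function.comp_apply, boxClamp_of_norm_sub_le (hzR t ht).le] at this
    exact ⟨_, this, (hD _ _).2 rfl⟩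
  · intro ε hε
    obtain ⟨δ, hδ0, hδ⟩ := htrap (min ε (r / 2)) (by positivity) r
      ((min_le_right _ _).trans_lt (by linarith)) le_rfl
    refine ⟨δ, hδ0, fun T z hz h0 t ht => ?_⟩
    exact (hδ T z (fun t ht => (hsol hz t ht).continuousWithinAt)
      (fun t ht _ => hsol hz t ht) h0 t ht).trans_le (min_le_left _ _)
  · obtain ⟨δ, hδ0, hδ⟩ := htrap (r / 2) (by positivity) r (by linarith) le_rfl
    refine ⟨δ, hδ0, fun z hz h0 => ?_⟩
    have hd := hsol hz
    have hzr : ∀ t ∈ Ici (0 : ℝ), ‖z t - p‖ < r := by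
      intro t ht
      have hd' : ∀ s ∈ Icc 0 t, HasDerivWithinAt z (v (z s)) (Icc 0 t) s := fun s hs =>
        (hd s hs.1).mono Icc_subset_Ici_self
      exact (hδ t z (fun s hs => (hd' s hs).continuousWithinAt) (fun s hs _ => hd' s hs) h0 t
        ⟨ht, le_rfl⟩).trans (by linarith)
    exact tendsto_of_lyapunov hV hlo hhi hc₁ hc₂ hc₃ hzr fun t ht =>
      ⟨_, hd t ht, hdec _ (hzr t ht)⟩

end UAVUGV

noncomputable section

namespace UAVUGV

section Energy

/-- Energy of a planar mechanical system with mass matrix `!![M, -m; -m, J]` and springs `k₁, k₂`,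
with a cross term of weight `c` between position and momentum. -/
def outerEnergy (M J m k₁ k₂ c q₁ v₁ q₂ v₂ : ℝ) : ℝ :=
  (M * v₁ ^ 2 - 2 * m * (v₁ * v₂) + J * v₂ ^ 2) / 2 + (k₁ * q₁ ^ 2 + k₂ * q₂ ^ 2) / 2 +
    c * (q₁ * (M * v₁ - m * v₂) + q₂ * (J * v₂ - m * v₁))

/-- Derivative of `outerEnergy` when `q₁, v₁, q₂, v₂` have the derivatives `p₁, w₁, p₂, w₂`. -/
def outerEnergyDeriv (M J m k₁ k₂ c q₁ v₁ q₂ v₂ p₁ w₁ p₂ w₂ : ℝ) : ℝ :=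
  M * v₁ * w₁ - m * (w₁ * v₂ + v₁ * w₂) + J * v₂ * w₂ + (k₁ * q₁ * p₁ + k₂ * q₂ * p₂) +
    c * (p₁ * (M * v₁ - m * v₂) + q₁ * (M * w₁ - m * w₂) +
      (p₂ * (J * v₂ - m * v₁) + q₂ * (J * w₂ - m * w₁)))

/-- Energy of a damped oscillator, with a cross term. -/
def innerEnergy (k I μ e ν : ℝ) : ℝ := (k * e ^ 2 + I * ν ^ 2) / 2 + μ * I * (e * ν)

/-- Derivative of `innerEnergy` when `e' = e₁` and `ν' = ν₁`. -/
def innerEnergyDeriv (k I μ e ν e₁ ν₁ : ℝ) : ℝ :=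
  k * e * e₁ + I * ν * ν₁ + μ * I * (e₁ * ν + e * ν₁)

theorem kinetic_lower {M J m : ℝ} (hM : 0 < M) (hJ : 0 < J) (v₁ v₂ : ℝ) :
    (M * J - m ^ 2) / (M + J) * (v₁ ^ 2 + v₂ ^ 2) ≤
      M * v₁ ^ 2 - 2 * m * (v₁ * v₂) + J * v₂ ^ 2 := by
  rw [div_mul_eq_mul_div, div_le_iff₀ (by positivity)]
  nlinarith [sq_nonneg (M * v₁ - m * v₂), sq_nonneg (m * v₁ - J * v₂)]

theorem abs_mul_le_sq_add {s t : ℝ} : |s * t| ≤ (s ^ 2 + t ^ 2) / 2 := by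
  rw [abs_le]
  constructor <;> nlinarith [sq_nonneg (s + t), sq_nonneg (s - t)]

theorem abs_mul_sub_mul_le {A M m s v w : ℝ} (hM : |M| ≤ A) (hm : |m| ≤ A) :
    |s * (M * v - m * w)| ≤ A * (s ^ 2 + v ^ 2 + w ^ 2) := by
  have h1 : |M * (s * v)| ≤ A * ((s ^ 2 + v ^ 2) / 2) := by
    rw [abs_mul]; exact mul_le_mul hM abs_mul_le_sq_add (abs_nonneg _) ((abs_nonneg _).trans hM)
  have h2 : |m * (s * w)| ≤ A * ((s ^ 2 + w ^ 2) / 2) := by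
    rw [abs_mul]; exact mul_le_mul hm abs_mul_le_sq_add (abs_nonneg _) ((abs_nonneg _).trans hm)
  have h3 : s * (M * v - m * w) = M * (s * v) - m * (s * w) := by ring
  rw [h3]
  have h4 := abs_sub (M * (s * v)) (m * (s * w))
  have hA : 0 ≤ A := (abs_nonneg _).trans hM
  have h5 : 0 ≤ A * v ^ 2 := by positivity
  have h6 : 0 ≤ A * w ^ 2 := by positivity
  linarith

theorem sq_sum_abs_le (q₁ v₁ q₂ v₂ : ℝ) :
    (|q₁| + |v₁| + |q₂| + |v₂|) ^ 2 ≤ 4 * (q₁ ^ 2 + v₁ ^ 2 + q₂ ^ 2 + v₂ ^ 2) := by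
  rw [← sq_abs q₁, ← sq_abs v₁, ← sq_abs q₂, ← sq_abs v₂]
  nlinarith [sq_nonneg (|q₁| - |v₁|), sq_nonneg (|q₁| - |q₂|), sq_nonneg (|q₁| - |v₂|),
    sq_nonneg (|v₁| - |q₂|), sq_nonneg (|v₁| - |v₂|), sq_nonneg (|q₂| - |v₂|)]

theorem sum_sq_le_sq_sum_abs (q₁ v₁ q₂ v₂ : ℝ) :
    q₁ ^ 2 + v₁ ^ 2 + q₂ ^ 2 + v₂ ^ 2 ≤ (|q₁| + |v₁| + |q₂| + |v₂|) ^ 2 := by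
  rw [← sq_abs q₁, ← sq_abs v₁, ← sq_abs q₂, ← sq_abs v₂]
  have := abs_nonneg q₁
  have := abs_nonneg v₁
  have := abs_nonneg q₂
  have := abs_nonneg v₂
  have : 0 ≤ |q₁| * |v₁| + |q₁| * |q₂| + |q₁| * |v₂| + |v₁| * |q₂| + |v₁| * |v₂| + |q₂| * |v₂| := by
    positivity
  nlinarith

theorem mul_abs_cross_le {k d q v : ℝ} (hk : 0 < k) :
    -(d * (q * v)) ≤ k / 2 * q ^ 2 + d ^ 2 / (2 * k) * v ^ 2 := by
  have h : k / 2 * q ^ 2 + d ^ 2 / (2 * k) * v ^ 2 + d * (q * v) = (k * q + d * v) ^ 2 / (2 * k) := by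
    field_simp
    ring
  have : 0 ≤ (k * q + d * v) ^ 2 / (2 * k) := by positivity
  linarith

set_option maxHeartbeats 800000 in
/-- For a small weight of the cross term, `outerEnergy` is a strict quadratic Lyapunov function of
a fully damped planar mechanical system, with linear gain from forces to its decay rate. -/
theorem exists_outerEnergy_bounds {M J m k₁ k₂ d₁ d₂ : ℝ} (hM : 0 < M) (hJ : 0 < J)
    (hdet : m ^ 2 < M * J) (hk₁ : 0 < k₁) (hk₂ : 0 < k₂) (hd₁ : 0 < d₁) (hd₂ : 0 < d₂) :
    ∃ c > 0, ∃ a > 0, ∃ b > 0, ∃ lo > 0, ∃ hi > 0, ∀ q₁ v₁ q₂ v₂ : ℝ,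
      lo * (|q₁| + |v₁| + |q₂| + |v₂|) ^ 2 ≤ outerEnergy M J m k₁ k₂ c q₁ v₁ q₂ v₂ ∧
      outerEnergy M J m k₁ k₂ c q₁ v₁ q₂ v₂ ≤ hi * (|q₁| + |v₁| + |q₂| + |v₂|) ^ 2 ∧
      ∀ w₁ w₂ f₁ f₂ : ℝ, M * w₁ - m * w₂ = -k₁ * q₁ - d₁ * v₁ + f₁ →
        J * w₂ - m * w₁ = -k₂ * q₂ - d₂ * v₂ + f₂ →
        outerEnergyDeriv M J m k₁ k₂ c q₁ v₁ q₂ v₂ v₁ w₁ v₂ w₂ ≤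
          -a * (|q₁| + |v₁| + |q₂| + |v₂|) ^ 2 +
            b * (|q₁| + |v₁| + |q₂| + |v₂|) * (|f₁| + |f₂|) := by
  set k₀ := (M * J - m ^ 2) / (M + J) with hk₀
  have hk₀0 : 0 < k₀ := div_pos (by linarith) (by linarith)
  set A := M + J + |m| with hA
  have hm0 := abs_nonneg m
  have hA0 : 0 < A := by positivity
  have hAM : |M| ≤ A := by rw [abs_of_pos hM]; linarith
  have hAJ : |J| ≤ A := by rw [abs_of_pos hJ]; linarith
  have hAm : |m| ≤ A := by linarith
  set l := min k₀ (min k₁ k₂) / 2 with hl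
  have hl0 : 0 < l := by positivity
  have hlk₀ : l ≤ k₀ / 2 := by
    rw [hl]; gcongr; exact min_le_left _ _
  have hlk₁ : l ≤ k₁ / 2 := by
    rw [hl]; gcongr; exact (min_le_right _ _).trans (min_le_left _ _)
  have hlk₂ : l ≤ k₂ / 2 := by
    rw [hl]; gcongr; exact (min_le_right _ _).trans (min_le_right _ _)
  set B := 4 * A + d₁ ^ 2 / (2 * k₁) + d₂ ^ 2 / (2 * k₂) with hB
  have hB0 : 0 < B := by positivity
  set d := min d₁ d₂ with hd
  have hd0 : 0 < d := lt_min hd₁ hd₂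
  set c := min (l / (4 * A)) (d / (2 * B)) with hc
  have hc0 : 0 < c := lt_min (by positivity) (by positivity)
  have hcA : c * (2 * A) ≤ l / 2 := by
    have : c ≤ l / (4 * A) := min_le_left _ _
    rw [le_div_iff₀ (by positivity)] at this
    linarith
  have hcB : c * B ≤ d / 2 := by
    have : c ≤ d / (2 * B) := min_le_right _ _
    rw [le_div_iff₀ (by positivity)] at this
    linarith
  set a := min (d / 2) (c * l) with ha
  have ha0 : 0 < a := lt_min (by positivity) (by positivity)
  have had : a ≤ d / 2 := min_le_left _ _
  have hal : a ≤ c * l := min_le_right _ _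
  refine ⟨c, hc0, a / 4, by positivity, 1 + c, by positivity, l / 8, by positivity,
    2 * A + k₁ + k₂ + c * (2 * A), by positivity, fun q₁ v₁ q₂ v₂ => ?_⟩
  set X := |q₁| + |v₁| + |q₂| + |v₂| with hX
  set s := q₁ ^ 2 + v₁ ^ 2 + q₂ ^ 2 + v₂ ^ 2 with hs
  have hXs : X ^ 2 ≤ 4 * s := sq_sum_abs_le _ _ _ _
  have hsX : s ≤ X ^ 2 := sum_sq_le_sq_sum_abs _ _ _ _
  have hs0 : 0 ≤ s := by positivity
  have hkin := kinetic_lower (m := m) hM hJ v₁ v₂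
  have e1 := abs_le.1 (abs_mul_sub_mul_le (s := q₁) (v := v₁) (w := v₂) hAM hAm)
  have e2 := abs_le.1 (abs_mul_sub_mul_le (s := q₂) (v := v₂) (w := v₁) hAJ hAm)
  have e3 := abs_le.1 (abs_mul_sub_mul_le (s := v₁) (v := v₁) (w := v₂) hAM hAm)
  have e4 := abs_le.1 (abs_mul_sub_mul_le (s := v₂) (v := v₂) (w := v₁) hAJ hAm)
  have sq1 := sq_nonneg q₁
  have sq2 := sq_nonneg v₁
  have sq3 := sq_nonneg q₂
  have sq4 := sq_nonneg v₂
  have hcross : |q₁ * (M * v₁ - m * v₂) + q₂ * (J * v₂ - m * v₁)| ≤ 2 * A * s := by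
    have : 0 ≤ A * q₁ ^ 2 + A * q₂ ^ 2 := by positivity
    rw [abs_le]; constructor <;> rw [hs] <;> linarith
  have hcross' : |c * (q₁ * (M * v₁ - m * v₂) + q₂ * (J * v₂ - m * v₁))| ≤ c * (2 * A) * s := by
    rw [abs_mul, abs_of_pos hc0, mul_assoc]
    exact mul_le_mul_of_nonneg_left hcross hc0.le
  have hcross'' := abs_le.1 hcross'
  have hquad : l * s ≤ k₀ / 2 * (v₁ ^ 2 + v₂ ^ 2) + (k₁ * q₁ ^ 2 + k₂ * q₂ ^ 2) / 2 := by
    have h1 := mul_le_mul_of_nonneg_right hlk₀ (add_nonneg sq2 sq4)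
    have h2 := mul_le_mul_of_nonneg_right hlk₁ sq1
    have h3 := mul_le_mul_of_nonneg_right hlk₂ sq3
    rw [hs]; linarith
  have hcAs : c * (2 * A) * s ≤ l / 2 * s := by gcongr
  refine ⟨?_, ?_, ?_⟩
  · have : l / 8 * X ^ 2 ≤ l / 8 * (4 * s) := by gcongr
    rw [outerEnergy]
    linarith [hcross''.1]
  · have h1 : (2 * A + k₁ + k₂ + c * (2 * A)) * s ≤ (2 * A + k₁ + k₂ + c * (2 * A)) * X ^ 2 := by gcongr
    have h2 : M * v₁ ^ 2 - 2 * m * (v₁ * v₂) + J * v₂ ^ 2 ≤ 3 * A * s := by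
      have h10 : 0 ≤ A * q₁ ^ 2 + A * q₂ ^ 2 := by positivity
      rw [hs]
      linarith [e3.2, e4.2]
    have h3 : (k₁ * q₁ ^ 2 + k₂ * q₂ ^ 2) / 2 ≤ (k₁ + k₂) * s := by
      have h4 : k₁ * q₁ ^ 2 ≤ k₁ * s := by gcongr; rw [hs]; linarith
      have h5 : k₂ * q₂ ^ 2 ≤ k₂ * s := by gcongr; rw [hs]; linarith
      have h6 : 0 ≤ k₁ * s + k₂ * s := by positivity
      linarith
    have h7 : 0 ≤ A * s := by positivity
    rw [outerEnergy]
    linarith [hcross''.2]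
  · intro w₁ w₂ f₁ f₂ h1 h2
    have hrew : outerEnergyDeriv M J m k₁ k₂ c q₁ v₁ q₂ v₂ v₁ w₁ v₂ w₂ =
        -d₁ * v₁ ^ 2 - d₂ * v₂ ^ 2 + c * (v₁ * (M * v₁ - m * v₂) + v₂ * (J * v₂ - m * v₁)) -
        c * (k₁ * q₁ ^ 2 + k₂ * q₂ ^ 2) + c * (-(d₁ * (q₁ * v₁)) + -(d₂ * (q₂ * v₂))) +
        ((v₁ + c * q₁) * f₁ + (v₂ + c * q₂) * f₂) := by
      rw [outerEnergyDeriv]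
      linear_combination (v₁ + c * q₁) * h1 + (v₂ + c * q₂) * h2
    have t1 := mul_abs_cross_le (d := d₁) (q := q₁) (v := v₁) hk₁
    have t2 := mul_abs_cross_le (d := d₂) (q := q₂) (v := v₂) hk₂
    have hinner : v₁ * (M * v₁ - m * v₂) + v₂ * (J * v₂ - m * v₁) - (k₁ * q₁ ^ 2 + k₂ * q₂ ^ 2) +
        (-(d₁ * (q₁ * v₁)) + -(d₂ * (q₂ * v₂))) ≤
        B * (v₁ ^ 2 + v₂ ^ 2) - (l * q₁ ^ 2 + l * q₂ ^ 2) := by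
      have n1 : 0 ≤ d₁ ^ 2 / (2 * k₁) * v₂ ^ 2 := by positivity
      have n2 : 0 ≤ d₂ ^ 2 / (2 * k₂) * v₁ ^ 2 := by positivity
      have n3 : 0 ≤ A * v₁ ^ 2 := by positivity
      have n4 : 0 ≤ A * v₂ ^ 2 := by positivity
      have n5 := mul_le_mul_of_nonneg_right hlk₁ sq1
      have n6 := mul_le_mul_of_nonneg_right hlk₂ sq3
      rw [hB]
      linarith [e3.2, e4.2]
    have hinner' := mul_le_mul_of_nonneg_left hinner hc0.le
    have hcB' : c * B * (v₁ ^ 2 + v₂ ^ 2) ≤ d / 2 * (v₁ ^ 2 + v₂ ^ 2) := by gcongr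
    have g1 : d * v₁ ^ 2 ≤ d₁ * v₁ ^ 2 := by gcongr; exact min_le_left _ _
    have g2 : d * v₂ ^ 2 ≤ d₂ * v₂ ^ 2 := by gcongr; exact min_le_right _ _
    have g3 : a * (v₁ ^ 2 + v₂ ^ 2) ≤ d / 2 * (v₁ ^ 2 + v₂ ^ 2) := by gcongr
    have g4 : a * (q₁ ^ 2 + q₂ ^ 2) ≤ c * l * (q₁ ^ 2 + q₂ ^ 2) := by gcongr
    have hforce : (v₁ + c * q₁) * f₁ + (v₂ + c * q₂) * f₂ ≤ (1 + c) * X * (|f₁| + |f₂|) := by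
      have b1 : |v₁ + c * q₁| ≤ (1 + c) * X := by
        have := abs_add_le v₁ (c * q₁)
        rw [abs_mul, abs_of_pos hc0] at this
        have : 0 ≤ |q₁| + |q₂| + |v₂| + c * |v₁| + c * |q₂| + c * |v₂| := by positivity
        rw [hX]; linarith
      have b2 : |v₂ + c * q₂| ≤ (1 + c) * X := by
        have := abs_add_le v₂ (c * q₂)
        rw [abs_mul, abs_of_pos hc0] at this
        have : 0 ≤ |q₁| + |q₂| + |v₁| + c * |v₁| + c * |q₁| + c * |v₂| := by positivity
        rw [hX]; linarith
      have b3 := le_abs_self ((v₁ + c * q₁) * f₁)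
      have b4 := le_abs_self ((v₂ + c * q₂) * f₂)
      rw [abs_mul] at b3 b4
      have b5 := mul_le_mul_of_nonneg_right b1 (abs_nonneg f₁)
      have b6 := mul_le_mul_of_nonneg_right b2 (abs_nonneg f₂)
      linarith
    have hfin : a / 4 * X ^ 2 ≤ a * s := by
      have := mul_le_mul_of_nonneg_left hXs (by positivity : 0 ≤ a / 4)
      linarith
    have hsplit : a * s = a * (v₁ ^ 2 + v₂ ^ 2) + a * (q₁ ^ 2 + q₂ ^ 2) := by rw [hs]; ring
    rw [hrew]
    linarith

end Energy

section Gains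

/-- The quadratic form that bounds the decay of the coupled energy is negative definite. Here `a`
is the decay rate of the outer loop, `b` its gain from the attitude error, and `R`, `C` bound the
rate of the attitude reference in terms of the outer state and of the attitude error. -/
def GainCondition (a b R C I k d : ℝ) : Prop :=
  ∃ μ > 0, ∃ h > 0, ∃ c > 0, μ ^ 2 * I < k ∧ ∀ X e ν : ℝ, 0 ≤ X → 0 ≤ e → 0 ≤ ν →
    -a * X ^ 2 + b * (X * e) + h * (k * e * (R * X + C * e) - (d - μ * I) * ν ^ 2 -
      μ * k * e ^ 2 + μ * d * (e * ν) + μ * I * ((R * X + C * e) * ν)) ≤ -c * (X + e + ν) ^ 2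

theorem neg_sq_sum_le {c a₁ a₂ a₃ X e ν : ℝ} (hc : 0 ≤ c) (h1 : 3 * c ≤ a₁) (h2 : 3 * c ≤ a₂)
    (h3 : 3 * c ≤ a₃) : -a₁ * X ^ 2 - a₂ * e ^ 2 - a₃ * ν ^ 2 ≤ -c * (X + e + ν) ^ 2 := by
  have i1 := mul_le_mul_of_nonneg_right h1 (sq_nonneg X)
  have i2 := mul_le_mul_of_nonneg_right h2 (sq_nonneg e)
  have i3 := mul_le_mul_of_nonneg_right h3 (sq_nonneg ν)
  have i4 : 0 ≤ c * ((X - e) ^ 2 + (X - ν) ^ 2 + (e - ν) ^ 2) := by positivity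
  linarith

/-- `p x y ≤ s x² + t y²` when `p² ≤ 4 s t`. -/
theorem mul_mul_le_of_sq_le {p s t x y : ℝ} (hs : 0 < s) (h : p ^ 2 ≤ 4 * s * t) :
    p * (x * y) ≤ s * x ^ 2 + t * y ^ 2 := by
  have h1 : 0 ≤ (2 * s * x - p * y) ^ 2 := sq_nonneg _
  have h2 := mul_le_mul_of_nonneg_right h (sq_nonneg y)
  have h3 : 4 * s * (p * (x * y)) ≤ 4 * s * (s * x ^ 2 + t * y ^ 2) := by linarith
  exact le_of_mul_le_mul_left h3 (by positivity)

theorem gainCondition_of_decoupled {a R I k d : ℝ} (ha : 0 < a) (hI : 0 < I)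
    (hk : 0 < k) (hd : 0 < d) : GainCondition a 0 R 0 I k d := by
  obtain ⟨μ, ⟨h1, h2, h3⟩, hμ⟩ : ∃ μ : ℝ, (μ ^ 2 * I < k ∧ μ * I < d / 4 ∧ μ * d < k / 2) ∧
      0 < μ := by
    have c1 : Tendsto (fun μ : ℝ => μ ^ 2 * I) (𝓝[>] 0) (𝓝 0) := by
      have : Continuous fun μ : ℝ => μ ^ 2 * I := by fun_prop
      simpa using (this.tendsto 0).mono_left nhdsWithin_le_nhds
    have c2 : ∀ s : ℝ, Tendsto (fun μ : ℝ => μ * s) (𝓝[>] 0) (𝓝 0) := fun s => by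
      have : Continuous fun μ : ℝ => μ * s := by fun_prop
      simpa using (this.tendsto 0).mono_left nhdsWithin_le_nhds
    exact (((c1.eventually (gt_mem_nhds hk)).and (((c2 I).eventually
      (gt_mem_nhds (by positivity : 0 < d / 4))).and ((c2 d).eventually
      (gt_mem_nhds (by positivity : 0 < k / 2))))).and self_mem_nhdsWithin).exists
  set Q := k * R ^ 2 / μ + (μ * I * R) ^ 2 / d with hQ
  have hQ0 : 0 ≤ Q := by positivity
  set h := a / (2 * (Q + 1)) with hh
  have hh0 : 0 < h := by positivity
  have hhQ : h * Q ≤ a / 2 := by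
    rw [hh, div_mul_eq_mul_div, div_le_div_iff₀ (by positivity) (by positivity)]
    nlinarith
  set c := min (a / 2) (min (h * (μ * k / 4)) (h * (d / 4))) / 3 with hc
  have hc0 : 0 < c := by positivity
  refine ⟨μ, hμ, h, hh0, c, hc0, h1, fun X e ν hX he hν => ?_⟩
  have p1 : k * R * (X * e) ≤ k * R ^ 2 / μ * X ^ 2 + μ * k / 4 * e ^ 2 := by
    rw [mul_comm X e, add_comm]
    refine mul_mul_le_of_sq_le (by positivity) (le_of_eq ?_)
    field_simp
  have p2 : μ * I * R * (X * ν) ≤ (μ * I * R) ^ 2 / d * X ^ 2 + d / 4 * ν ^ 2 := by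
    rw [mul_comm X ν, add_comm]
    refine mul_mul_le_of_sq_le (by positivity) (le_of_eq ?_)
    field_simp
  have p3 : μ * d * (e * ν) ≤ μ * k / 2 * e ^ 2 + d / 4 * ν ^ 2 := by
    refine mul_mul_le_of_sq_le (by positivity) ?_
    nlinarith [mul_pos hμ hd]
  have p4 : μ * I * ν ^ 2 ≤ d / 4 * ν ^ 2 := by gcongr
  have p5 : k * e * (R * X + 0 * e) - (d - μ * I) * ν ^ 2 -
      μ * k * e ^ 2 + μ * d * (e * ν) + μ * I * ((R * X + 0 * e) * ν) ≤
      Q * X ^ 2 - μ * k / 4 * e ^ 2 - d / 4 * ν ^ 2 := by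
    rw [hQ]
    linarith
  have p6 := mul_le_mul_of_nonneg_left p5 hh0.le
  have p7 := mul_le_mul_of_nonneg_right hhQ (sq_nonneg X)
  refine le_trans ?_ (neg_sq_sum_le (c := c) hc0.le (a₁ := a / 2) (a₂ := h * (μ * k / 4))
    (a₃ := h * (d / 4)) ?_ ?_ ?_)
  · linarith
  · rw [hc]; linarith [min_le_left (a / 2) (min (h * (μ * k / 4)) (h * (d / 4)))]
  · rw [hc]; linarith [(min_le_right (a / 2) (min (h * (μ * k / 4)) (h * (d / 4)))).trans
      (min_le_left _ _)]
  · rw [hc]; linarith [(min_le_right (a / 2) (min (h * (μ * k / 4)) (h * (d / 4)))).trans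
      (min_le_right _ _)]

theorem exists_gainCondition {a b R C I : ℝ} (ha : 0 < a) (hC : 0 ≤ C)
    (hI : 0 < I) : ∃ Kv > 0, ∀ d > Kv, ∃ Kp > 0, ∀ k > Kp, GainCondition a b R C I k d := by
  refine ⟨2 * I * (C + (b + R) ^ 2 / a + 1), by positivity, fun d hd => ?_⟩
  set μ := d / (2 * I) with hμ
  have hμI : μ * I = d / 2 := by rw [hμ]; field_simp
  have hμC : C + (b + R) ^ 2 / a + 1 < μ := by
    rw [hμ, lt_div_iff₀ (by positivity)]; linarith
  have hq : 0 ≤ (b + R) ^ 2 / a := by positivity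
  have hμ0 : 0 < μ := by linarith
  have hd0 : 0 < d := lt_trans (by positivity) hd
  have hbR : (b + R) ^ 2 ≤ a * (μ - C) := by
    have : (b + R) ^ 2 / a ≤ μ - C := by linarith
    rwa [div_le_iff₀' ha] at this
  refine ⟨μ ^ 2 * I + 2 * d * R ^ 2 / a + 2 * d * (2 * μ + C) ^ 2 / (μ - C), ?_, fun k hk => ?_⟩
  · have : 0 < μ - C := by linarith
    positivity
  have hμC0 : 0 < μ - C := by linarith
  have t1 : 0 ≤ μ ^ 2 * I := by positivity
  have t2 : 0 ≤ 2 * d * R ^ 2 / a := by positivity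
  have t3 : 0 ≤ 2 * d * (2 * μ + C) ^ 2 / (μ - C) := by positivity
  have hk0 : 0 < k := by linarith
  set p := d / (2 * k) with hp
  have hp0 : 0 < p := by positivity
  have hp1 : p * R ^ 2 ≤ a / 4 := by
    have : 2 * d * R ^ 2 / a ≤ k := by linarith
    rw [div_le_iff₀ ha] at this
    rw [hp, div_mul_eq_mul_div, div_le_div_iff₀ (by positivity) (by positivity)]
    linarith
  have hp2 : p * (2 * μ + C) ^ 2 ≤ (μ - C) / 4 := by
    have : 2 * d * (2 * μ + C) ^ 2 / (μ - C) ≤ k := by linarith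
    rw [div_le_iff₀ hμC0] at this
    rw [hp, div_mul_eq_mul_div, div_le_div_iff₀ (by positivity) (by positivity)]
    linarith
  set c := min (a / 4) (min ((μ - C) / 4) (p / 2)) / 3 with hc
  have hc0 : 0 < c := by positivity
  refine ⟨μ, hμ0, 1 / k, by positivity, c, hc0, by linarith, fun X e ν hX he hν => ?_⟩
  have hrew : -a * X ^ 2 + b * (X * e) + 1 / k * (k * e * (R * X + C * e) - (d - μ * I) * ν ^ 2 -
      μ * k * e ^ 2 + μ * d * (e * ν) + μ * I * ((R * X + C * e) * ν)) =
      -a * X ^ 2 + (b + R) * (X * e) - (μ - C) * e ^ 2 +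
        p * (-ν ^ 2 + (2 * μ + C) * (e * ν) + R * (X * ν)) := by
    rw [hμI, hp]
    field_simp
    ring
  have q1 : (2 * μ + C) * (e * ν) ≤ (2 * μ + C) ^ 2 * e ^ 2 + 1 / 4 * ν ^ 2 := by
    have := mul_mul_le_of_sq_le (p := 2 * μ + C) (s := 1 / 4) (t := (2 * μ + C) ^ 2) (x := ν)
      (y := e) (by norm_num) (by linarith)
    linarith
  have q2 : R * (X * ν) ≤ R ^ 2 * X ^ 2 + 1 / 4 * ν ^ 2 := by
    have := mul_mul_le_of_sq_le (p := R) (s := 1 / 4) (t := R ^ 2) (x := ν) (y := X)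
      (by norm_num) (by linarith)
    linarith
  have q3 : (b + R) * (X * e) ≤ a / 2 * X ^ 2 + (μ - C) / 2 * e ^ 2 :=
    mul_mul_le_of_sq_le (by positivity) (by linarith)
  have q4 : p * (-ν ^ 2 + (2 * μ + C) * (e * ν) + R * (X * ν)) ≤
      p * (-(1 / 2) * ν ^ 2 + (2 * μ + C) ^ 2 * e ^ 2 + R ^ 2 * X ^ 2) :=
    mul_le_mul_of_nonneg_left (by linarith) hp0.le
  have q5 := mul_le_mul_of_nonneg_right hp1 (sq_nonneg X)
  have q6 := mul_le_mul_of_nonneg_right hp2 (sq_nonneg e)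
  rw [hrew]
  refine le_trans ?_ (neg_sq_sum_le (c := c) hc0.le (a₁ := a / 4) (a₂ := (μ - C) / 4)
    (a₃ := p / 2) ?_ ?_ ?_)
  · linarith
  · rw [hc]; linarith [min_le_left (a / 4) (min ((μ - C) / 4) (p / 2))]
  · rw [hc]; linarith [(min_le_right (a / 4) (min ((μ - C) / 4) (p / 2))).trans (min_le_left _ _)]
  · rw [hc]; linarith [(min_le_right (a / 4) (min ((μ - C) / 4) (p / 2))).trans (min_le_right _ _)]

/-- Robust version of the gain condition: small relative perturbations do not spoil the decay. -/
theorem GainCondition.exists_decay {a b R T I k d : ℝ} (hb : 0 ≤ b) (hR : 0 ≤ R)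
    (hI : 0 < I) (hd : 0 < d) (hG : GainCondition a (b * T) R (R * T) I k d) :
    ∃ μ > 0, ∃ h > 0, ∃ c > 0, ∃ η > 0, μ ^ 2 * I < k ∧
      ∀ X e ν ρ D r s : ℝ, 0 ≤ X → s ≤ -a * X ^ 2 + b * X * D → |ρ| ≤ R * (X + D) →
        D ≤ T * |e| + 3 * η * (X + |e| + |ν|) → |r| ≤ η * (X + |e| + |ν|) →
        ∀ ν₁, I * ν₁ = -k * (e + r) - d * ν →
        s + h * innerEnergyDeriv k I μ e ν (ν - ρ) ν₁ ≤ -c * (X + |e| + |ν|) ^ 2 := by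
  obtain ⟨μ, hμ, h, hh, c, hc, hμk, hineq⟩ := hG
  have hk : 0 < k := lt_of_le_of_lt (by positivity) hμk
  set Q := 3 * b + h * (3 * R * k + 3 * R * (μ * I) + k * (1 + μ)) with hQ
  have hQ0 : 0 ≤ Q := by positivity
  refine ⟨μ, hμ, h, hh, c / 2, by positivity, c / (2 * (Q + 1)), by positivity, hμk, ?_⟩
  set η := c / (2 * (Q + 1)) with hη
  have hη0 : 0 < η := by positivity
  have hηQ : η * Q ≤ c / 2 := by
    rw [hη, div_mul_eq_mul_div, div_le_div_iff₀ (by positivity) (by positivity)]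
    nlinarith
  intro X e ν ρ D r s hX hs hρ hD hr ν₁ hν₁
  have he0 := abs_nonneg e
  have hν0 := abs_nonneg ν
  set N := X + |e| + |ν| with hN
  have hN0 : 0 ≤ N := by positivity
  have hXN : X ≤ N := by linarith
  have heN : |e| ≤ N := by linarith
  have hνN : |ν| ≤ N := by linarith
  have hmain := hineq X |e| |ν| hX he0 hν0
  have hs' : s ≤ -a * X ^ 2 + b * T * (X * |e|) + 3 * b * (η * N ^ 2) := by
    have i1 : b * X * D ≤ b * X * (T * |e| + 3 * η * N) := by gcongr
    have i2 : b * X * (3 * η * N) ≤ b * N * (3 * η * N) := by gcongr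
    linarith
  have hρ' : |ρ| ≤ (R * X + R * T * |e|) + 3 * R * η * N := by
    have : R * (X + D) ≤ R * (X + (T * |e| + 3 * η * N)) := by gcongr
    linarith
  have hexp : innerEnergyDeriv k I μ e ν (ν - ρ) ν₁ =
      -(d - μ * I) * ν ^ 2 - μ * k * e ^ 2 + (-(k * e * ρ) + -(μ * d * (e * ν)) +
        -(μ * I * (ρ * ν)) + -(k * r * (ν + μ * e))) := by
    rw [innerEnergyDeriv]
    linear_combination (ν + μ * e) * hν₁
  have j1 : -(k * e * ρ) ≤ k * |e| * (R * X + R * T * |e|) + 3 * R * k * (η * N ^ 2) := by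
    have i1 := neg_abs_le (k * e * ρ)
    rw [abs_mul, abs_mul, abs_of_pos hk] at i1
    have i2 : k * |e| * |ρ| ≤ k * |e| * ((R * X + R * T * |e|) + 3 * R * η * N) := by gcongr
    have i3 : k * |e| * (3 * R * η * N) ≤ k * N * (3 * R * η * N) := by gcongr
    linarith
  have j2 : -(μ * d * (e * ν)) ≤ μ * d * (|e| * |ν|) := by
    have i1 := neg_abs_le (e * ν)
    rw [abs_mul] at i1
    have : μ * d * -(e * ν) ≤ μ * d * (|e| * |ν|) := by gcongr; linarith
    linarith
  have j3 : -(μ * I * (ρ * ν)) ≤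
      μ * I * ((R * X + R * T * |e|) * |ν|) + 3 * R * (μ * I) * (η * N ^ 2) := by
    have i1 := neg_abs_le (ρ * ν)
    rw [abs_mul] at i1
    have i2 : |ρ| * |ν| ≤ ((R * X + R * T * |e|) + 3 * R * η * N) * |ν| := by gcongr
    have i3 : 3 * R * η * N * |ν| ≤ 3 * R * η * N * N := by gcongr
    have i4 : μ * I * -(ρ * ν) ≤ μ * I * ((R * X + R * T * |e|) * |ν| + 3 * R * η * N * N) := by
      gcongr; linarith
    linarith
  have j4 : -(k * r * (ν + μ * e)) ≤ k * (1 + μ) * (η * N ^ 2) := by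
    have i1 := neg_abs_le (k * r * (ν + μ * e))
    rw [abs_mul, abs_mul, abs_of_pos hk] at i1
    have i2 : |ν + μ * e| ≤ (1 + μ) * N := by
      have := abs_add_le ν (μ * e)
      rw [abs_mul, abs_of_pos hμ] at this
      have : μ * |e| ≤ μ * N := by gcongr
      linarith
    have i3 : k * |r| * |ν + μ * e| ≤ k * (η * N) * ((1 + μ) * N) := by gcongr
    linarith
  have hdW : innerEnergyDeriv k I μ e ν (ν - ρ) ν₁ ≤
      (k * |e| * (R * X + R * T * |e|) - (d - μ * I) * |ν| ^ 2 -
      μ * k * |e| ^ 2 + μ * d * (|e| * |ν|) + μ * I * ((R * X + R * T * |e|) * |ν|)) +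
      (3 * R * k + 3 * R * (μ * I) + k * (1 + μ)) * (η * N ^ 2) := by
    rw [hexp, sq_abs, sq_abs]
    linarith
  have hdW' := mul_le_mul_of_nonneg_left hdW hh.le
  have hfin : Q * (η * N ^ 2) ≤ c / 2 * N ^ 2 := by
    have := mul_le_mul_of_nonneg_right hηQ (sq_nonneg N)
    linarith
  rw [hQ] at hfin
  linarith

theorem exists_innerEnergy_bounds {k I μ : ℝ} (hI : 0 < I) (hμ : 0 < μ) (hμk : μ ^ 2 * I < k) :
    ∃ lo > 0, ∃ hi > 0, ∀ e ν : ℝ, lo * (|e| + |ν|) ^ 2 ≤ innerEnergy k I μ e ν ∧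
      innerEnergy k I μ e ν ≤ hi * (|e| + |ν|) ^ 2 := by
  have hk : 0 < k := lt_of_le_of_lt (by positivity) hμk
  set l := (k * I - (-(μ * I)) ^ 2) / (k + I) with hl
  have hl0 : 0 < l := by
    refine div_pos ?_ (by positivity)
    have := mul_lt_mul_of_pos_right hμk hI
    linarith
  refine ⟨l / 4, by positivity, k + I + μ * I, by positivity, fun e ν => ?_⟩
  have he0 := abs_nonneg e
  have hν0 := abs_nonneg ν
  constructor
  · have h1 := kinetic_lower (m := -(μ * I)) hk hI e ν
    have h2 : (|e| + |ν|) ^ 2 ≤ 2 * (e ^ 2 + ν ^ 2) := by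
      rw [← sq_abs e, ← sq_abs ν]
      nlinarith [sq_nonneg (|e| - |ν|)]
    have h3 : l / 4 * (|e| + |ν|) ^ 2 ≤ l / 4 * (2 * (e ^ 2 + ν ^ 2)) := by gcongr
    rw [innerEnergy]
    linarith
  · have h1 : e * ν ≤ |e| * |ν| := by rw [← abs_mul]; exact le_abs_self _
    have h2 : μ * I * (e * ν) ≤ μ * I * (|e| * |ν|) := by gcongr
    have h3 : 0 ≤ (k + I + μ * I) * (|e| * |ν|) := by positivity
    have h4 : 0 ≤ μ * I * |e| ^ 2 + μ * I * |ν| ^ 2 + k * |e| ^ 2 + k * |ν| ^ 2 + I * |e| ^ 2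
      + I * |ν| ^ 2 := by positivity
    have h5 : 0 ≤ k * |e| ^ 2 := by positivity
    have h6 : 0 ≤ I * |ν| ^ 2 := by positivity
    have h7 : 0 ≤ k * |ν| ^ 2 := by positivity
    have h8 : 0 ≤ I * |e| ^ 2 := by positivity
    have h9 : 0 ≤ μ * I * |e| ^ 2 + μ * I * |ν| ^ 2 := by positivity
    have h10 : 0 ≤ k * (|e| * |ν|) := by positivity
    have h11 : 0 ≤ I * (|e| * |ν|) := by positivity
    have h12 : 0 ≤ μ * I * (|e| * |ν|) := by positivity
    rw [innerEnergy, ← sq_abs e, ← sq_abs ν]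
    linarith

end Gains

end UAVUGV

end

noncomputable section

namespace UAVUGV

section Saturation

theorem sat_eq_max_min {lam : ℝ} (hlam : 0 ≤ lam) (s : ℝ) : sat lam s = max (-lam) (min lam s) := by
  rw [sat]
  rcases lt_trichotomy s 0 with h | rfl | h
  · rw [Real.sign_of_neg h, abs_of_neg h, min_eq_right (by linarith : s ≤ lam), neg_one_mul,
      ← max_neg_neg, neg_neg, max_comm]
  · simp [hlam]
  · rw [Real.sign_of_pos h, abs_of_pos h, one_mul, min_comm, max_eq_right]
    exact le_min (by linarith) (by linarith)

theorem satPos_eq_max_min {lam : ℝ} (hlam : 0 ≤ lam) (s : ℝ) :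
    satPos lam s = max 0 (min lam s) := by
  rw [satPos, sat_eq_max_min hlam, max_comm, ← max_assoc, max_eq_left (by linarith : -lam ≤ 0)]

theorem abs_sat_le {lam : ℝ} (hlam : 0 ≤ lam) (s : ℝ) : |sat lam s| ≤ lam := by
  rw [sat_eq_max_min hlam, abs_le]
  exact ⟨le_max_left _ _, max_le (by linarith) (min_le_left _ _)⟩

theorem sat_of_abs_le {lam s : ℝ} (h : |s| ≤ lam) : sat lam s = s := by
  rw [sat_eq_max_min ((abs_nonneg s).trans h), min_eq_right (abs_le.1 h).2,
    max_eq_right (abs_le.1 h).1]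

/-- The point of the interval between `0` and `s` that is nearest to `f`. -/
def clampZero (f s : ℝ) : ℝ := max (min f (max s 0)) (min s 0)

theorem clampZero_of_le {f s : ℝ} (hf : 0 ≤ f) (h : f ≤ s) : clampZero f s = f := by
  rw [clampZero, max_eq_left (hf.trans h), min_eq_left h, min_eq_right (hf.trans h),
    max_eq_left hf]

theorem clampZero_neg (f s : ℝ) : clampZero (-f) (-s) = -clampZero f s := by
  simp only [clampZero, max_def, min_def]
  split_ifs <;> linarith

theorem satPos_div_mul {lam f s : ℝ} (hlam : 0 ≤ lam) :
    satPos lam (f / s) * s = clampZero f (lam * s) := by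
  have hpos : ∀ f s : ℝ, 0 < s → satPos lam (f / s) * s = clampZero f (lam * s) := by
    intro f s hs
    rw [satPos_eq_max_min hlam, max_mul_of_nonneg _ _ hs.le, min_mul_of_nonneg _ _ hs.le,
      div_mul_cancel₀ _ hs.ne', zero_mul, clampZero, max_eq_left (by positivity : 0 ≤ lam * s),
      min_eq_right (by positivity : 0 ≤ lam * s), max_comm, min_comm]
  rcases lt_trichotomy s 0 with h | rfl | h
  · have := hpos (-f) (-s) (by linarith)
    rw [neg_div_neg_eq, mul_neg, mul_neg, clampZero_neg] at this
    linarith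
  · simp [clampZero]
  · exact hpos f s h

theorem abs_clampZero_sub_clampZero_le (f s t : ℝ) :
    |clampZero f s - clampZero f t| ≤ |s - t| := by
  simp only [clampZero, max_def, min_def]
  have h1 := le_abs_self (s - t)
  have h2 := neg_le_abs (s - t)
  rw [abs_le]
  split_ifs <;> constructor <;> linarith

theorem locallyLipschitz_clampZero {α : Type*} [PseudoEMetricSpace α] {f s : α → ℝ}
    (hf : LocallyLipschitz f) (hs : LocallyLipschitz s) :
    LocallyLipschitz fun z => clampZero (f z) (s z) :=
  (hf.min (hs.max_const 0)).max (hs.min_const 0)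

end Saturation

section Attitude

theorem mul_arctan_le_mul_arctan {x y : ℝ} (hx : 0 ≤ x) (hxy : x ≤ y) :
    x * Real.arctan y ≤ y * Real.arctan x := by
  rcases hxy.eq_or_lt with rfl | hlt
  · exact le_rfl
  have hy : 0 < y := hx.trans_lt hlt
  have hconc : ConcaveOn ℝ (Ici 0) Real.arctan := by
    refine AntitoneOn.concaveOn_of_deriv (convex_Ici 0) Real.continuous_arctan.continuousOn
      Real.differentiable_arctan.differentiableOn ?_
    intro s hs t ht hst
    rw [interior_Ici, mem_Ioi] at hs ht
    simp only [Real.deriv_arctan]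
    gcongr
  have h := hconc.2 (mem_Ici.2 hy.le) (mem_Ici.2 le_rfl) (div_nonneg hx hy.le)
    (sub_nonneg.2 ((div_le_one hy).2 hxy)) (add_sub_cancel _ _)
  simp only [smul_eq_mul, Real.arctan_zero, mul_zero, add_zero, div_mul_cancel₀ _ hy.ne'] at h
  rw [div_mul_eq_mul_div, div_le_iff₀ hy] at h
  linarith

variable (P : Plant) (G : OuterGains)

theorem Plant.Tmax_mul_L_pos : 0 < P.Tmax * P.L := mul_pos P.Tmax_pos P.L_pos

theorem arctan_eps_pos : 0 < Real.arctan (G.ε * (P.Tmax * P.L)) :=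
  Real.arctan_pos.2 (mul_pos G.ε_pos P.Tmax_mul_L_pos)

theorem gam_pos : 0 < gam P G := by
  have := arctan_eps_pos P G
  have := Real.pi_pos
  rw [gam]
  positivity

theorem gam_mul_arctan : gam P G * Real.arctan (G.ε * (P.Tmax * P.L)) = Real.pi / 2 := by
  have := (arctan_eps_pos P G).ne'
  rw [gam, ← div_div, div_mul_cancel₀ _ this]

theorem thetaD_zero : thetaD P G 0 = 0 := by simp [thetaD, sat]

theorem sat_neg (lam s : ℝ) : sat lam (-s) = -sat lam s := by
  simp [sat, Real.sign_neg]

theorem thetaD_neg (f : ℝ) : thetaD P G (-f) = -thetaD P G f := by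
  rw [thetaD, thetaD, mul_neg, Real.arctan_neg, mul_neg, sat_neg]

theorem abs_gam_mul_arctan_le {f : ℝ} (hf : |f| ≤ P.Tmax * P.L) :
    |gam P G * Real.arctan (G.ε * f)| ≤ Real.pi / 2 := by
  rw [abs_mul, abs_of_pos (gam_pos P G), ← gam_mul_arctan P G]
  refine mul_le_mul_of_nonneg_left ?_ (gam_pos P G).le
  have hε := G.ε_pos
  obtain ⟨h1, h2⟩ := abs_le.1 hf
  rw [abs_le, ← Real.arctan_neg]
  constructor
  · refine Real.arctan_mono ?_
    have := mul_le_mul_of_nonneg_left h1 hε.le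
    linarith
  · exact Real.arctan_mono (mul_le_mul_of_nonneg_left h2 hε.le)

theorem thetaD_of_abs_le {f : ℝ} (hf : |f| ≤ P.Tmax * P.L) :
    thetaD P G f = gam P G * Real.arctan (G.ε * f) :=
  sat_of_abs_le (abs_gam_mul_arctan_le P G hf)

theorem abs_thetaD_le (f : ℝ) : |thetaD P G f| ≤ Real.pi / 2 :=
  abs_sat_le (by have := Real.pi_pos; positivity) _

theorem thetaD_pos {f : ℝ} (hf : 0 < f) (hf' : f ≤ P.Tmax * P.L) : 0 < thetaD P G f := by
  rw [thetaD_of_abs_le P G (by rwa [abs_of_pos hf])]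
  exact mul_pos (gam_pos P G) (Real.arctan_pos.2 (mul_pos G.ε_pos hf))

theorem le_mul_thetaD {f : ℝ} (hf : 0 < f) (hf' : f ≤ P.Tmax * P.L) :
    f ≤ P.Tmax * P.L * (2 / Real.pi * thetaD P G f) := by
  have hε := G.ε_pos
  have hA := arctan_eps_pos P G
  have h := mul_arctan_le_mul_arctan (x := G.ε * f) (by positivity)
    (mul_le_mul_of_nonneg_left hf' hε.le)
  have h' : f * Real.arctan (G.ε * (P.Tmax * P.L)) ≤
      P.Tmax * P.L * Real.arctan (G.ε * f) := by
    refine le_of_mul_le_mul_left (a := G.ε) ?_ hε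
    linarith
  have hpi := Real.pi_pos
  rw [thetaD_of_abs_le P G (by rwa [abs_of_pos hf]), gam]
  have : P.Tmax * P.L * (2 / Real.pi * (Real.pi / (2 * Real.arctan (G.ε * (P.Tmax * P.L))) *
      Real.arctan (G.ε * f))) =
      P.Tmax * P.L * Real.arctan (G.ε * f) / Real.arctan (G.ε * (P.Tmax * P.L)) := by
    field_simp
  rw [this, le_div_iff₀ hA]
  exact h'

/-- The thrust needed at the desired attitude does not exceed the available one. -/
theorem le_mul_sin_thetaD {f : ℝ} (hf : 0 ≤ f) (hf' : f ≤ P.Tmax * P.L) :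
    f ≤ P.Tmax * P.L * Real.sin (thetaD P G f) := by
  rcases hf.eq_or_lt with rfl | hf
  · simp [thetaD_zero]
  have hTL := P.Tmax_mul_L_pos
  refine (le_mul_thetaD P G hf hf').trans (mul_le_mul_of_nonneg_left ?_ hTL.le)
  exact Real.mul_le_sin (thetaD_pos P G hf hf').le (le_of_abs_le (abs_thetaD_le P G f))

theorem thetaD_lt {f : ℝ} (hf : 0 < f) (hf' : f < P.Tmax * P.L) :
    thetaD P G f < Real.pi / 2 := by
  rw [thetaD_of_abs_le P G (by rw [abs_of_pos hf]; exact hf'.le), ← gam_mul_arctan P G]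
  exact mul_lt_mul_of_pos_left (Real.arctan_strictMono (mul_lt_mul_of_pos_left hf' G.ε_pos))
    (gam_pos P G)

theorem lt_mul_sin_thetaD {f : ℝ} (hf : 0 < f) (hf' : f < P.Tmax * P.L) :
    f < P.Tmax * P.L * Real.sin (thetaD P G f) :=
  (le_mul_thetaD P G hf hf'.le).trans_lt (mul_lt_mul_of_pos_left
    (Real.mul_lt_sin (thetaD_pos P G hf hf'.le) (thetaD_lt P G hf hf')) P.Tmax_mul_L_pos)

theorem thrustNew_mul_sin (f θ : ℝ) :
    thrustNew P f θ * Real.sin θ = clampZero f (P.Tmax * P.L * Real.sin θ) :=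
  satPos_div_mul P.Tmax_mul_L_pos.le

theorem clampZero_sin_thetaD {f : ℝ} (hf : |f| ≤ P.Tmax * P.L) :
    clampZero f (P.Tmax * P.L * Real.sin (thetaD P G f)) = f := by
  obtain ⟨h1, h2⟩ := abs_le.1 hf
  rcases le_total 0 f with h | h
  · exact clampZero_of_le h (le_mul_sin_thetaD P G h h2)
  · have h3 := le_mul_sin_thetaD P G (f := -f) (by linarith) (by linarith)
    have h4 := clampZero_of_le (by linarith) h3
    rw [thetaD_neg, Real.sin_neg, mul_neg, clampZero_neg] at h4
    linarith

/-- The force error is bounded by the attitude error. -/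
theorem abs_clampZero_sub_le {f θ : ℝ} (hf : |f| ≤ P.Tmax * P.L) :
    |clampZero f (P.Tmax * P.L * Real.sin θ) - f| ≤ P.Tmax * P.L * |θ - thetaD P G f| := by
  have h := clampZero_sin_thetaD P G hf
  calc |clampZero f (P.Tmax * P.L * Real.sin θ) - f| =
        |clampZero f (P.Tmax * P.L * Real.sin θ) -
          clampZero f (P.Tmax * P.L * Real.sin (thetaD P G f))| := by rw [h]
    _ ≤ P.Tmax * P.L * |θ - thetaD P G f| := ?_
  refine (abs_clampZero_sub_clampZero_le _ _ _).trans ?_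
  rw [← mul_sub, abs_mul, abs_of_pos P.Tmax_mul_L_pos]
  refine mul_le_mul_of_nonneg_left ?_ P.Tmax_mul_L_pos.le
  have := Real.lipschitzWith_sin.dist_le_mul θ (thetaD P G f)
  simpa [Real.dist_eq] using this

end Attitude

section FeedForward

theorem sub_abs_le_arcsin {a e u : ℝ} (ha0 : 0 ≤ a) (ha : a ≤ Real.pi / 2)
    (h1 : min (Real.sin a) (Real.sin (a + e)) ≤ u) : a - |e| ≤ Real.arcsin u := by
  rcases le_or_gt (a - |e|) (-(Real.pi / 2)) with h | h
  · exact h.trans (Real.neg_pi_div_two_le_arcsin u)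
  have he := abs_nonneg e
  have hpi := Real.pi_pos
  rw [Real.le_arcsin_iff_sin_le' ⟨h, by linarith⟩]
  refine le_trans (le_min ?_ ?_) h1
  · exact Real.sin_le_sin_of_le_of_le_pi_div_two h.le ha (by linarith)
  · rcases le_total e 0 with h0 | h0
    · rw [abs_of_nonpos h0, sub_neg_eq_add]
    · rw [abs_of_nonneg h0] at h ⊢
      have hs : 0 ≤ Real.sin e := Real.sin_nonneg_of_nonneg_of_le_pi h0 (by linarith)
      have hc : 0 ≤ Real.cos a := Real.cos_nonneg_of_mem_Icc ⟨by linarith, ha⟩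
      rw [Real.sin_add, Real.sin_sub]
      have := mul_nonneg hc hs
      linarith

variable (P : Plant) (G : OuterGains)

theorem exists_feedForward_of_pos {f : ℝ} (e : ℝ) (hf : 0 < f) (hf' : f ≤ P.Tmax * P.L) :
    ∃ ψ : ℝ, |ψ| ≤ |e| ∧ f / Real.sin (thetaD P G f) * Real.sin (thetaD P G f + ψ) =
      clampZero f (P.Tmax * P.L * Real.sin (thetaD P G f + e)) := by
  set a := thetaD P G f with ha
  have ha0 : 0 < a := thetaD_pos P G hf hf'
  have hapi : a ≤ Real.pi / 2 := le_of_abs_le (abs_thetaD_le P G f)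
  have hs0 : 0 < Real.sin a := Real.sin_pos_of_pos_of_lt_pi ha0 (by linarith [Real.pi_pos])
  have hs1 := le_mul_sin_thetaD P G hf.le hf'
  rw [← ha] at hs1
  have hTL := P.Tmax_mul_L_pos
  set F := clampZero f (P.Tmax * P.L * Real.sin (a + e)) with hF
  have hF0 : 0 ≤ F := by
    rw [hF, clampZero]
    exact (le_min hf.le (le_max_right _ _)).trans (le_max_left _ _)
  have hF1 : F ≤ f := by
    rw [hF, clampZero]
    exact max_le (min_le_left _ _) ((min_le_right _ _).trans hf.le)
  set u := Real.sin a * (F / f) with hu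
  have hu0 : 0 ≤ u := by positivity
  have hu1 : u ≤ Real.sin a := mul_le_of_le_one_right hs0.le ((div_le_one hf).2 hF1)
  have hmin : min (Real.sin a) (Real.sin (a + e)) ≤ u := by
    rcases le_or_gt (Real.sin (a + e)) 0 with h | h
    · exact (min_le_right _ _).trans (h.trans hu0)
    have hFm : F = min f (P.Tmax * P.L * Real.sin (a + e)) := by
      have h3 : 0 ≤ P.Tmax * P.L * Real.sin (a + e) := by positivity
      rw [hF, clampZero, max_eq_left h3, min_eq_right h3, max_eq_left (le_min hf.le h3)]
    rcases le_total f (P.Tmax * P.L * Real.sin (a + e)) with h2 | h2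
    · rw [min_eq_left h2] at hFm
      rw [hu, hFm, div_self hf.ne', mul_one]
      exact min_le_left _ _
    · rw [min_eq_right h2] at hFm
      refine (min_le_right _ _).trans ?_
      rw [hu, hFm, ← mul_div_assoc, le_div_iff₀ hf]
      have := mul_le_mul_of_nonneg_right hs1 h.le
      linarith
  have hle := sub_abs_le_arcsin ha0.le hapi hmin
  have hge : Real.arcsin u ≤ a := by
    rw [← Real.arcsin_sin (by linarith) hapi]
    exact Real.monotone_arcsin hu1
  refine ⟨Real.arcsin u - a, ?_, ?_⟩
  · rw [abs_of_nonpos (by linarith)]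
    linarith
  · rw [add_sub_cancel, Real.sin_arcsin (by linarith) (hu1.trans (Real.sin_le_one a)), hu]
    field_simp

/-- The new thrust law is the first one with a reduced attitude error. -/
theorem exists_feedForward {f : ℝ} (e : ℝ) (hf : |f| ≤ P.Tmax * P.L) :
    ∃ ψ : ℝ, |ψ| ≤ |e| ∧ thrustOld P G f * Real.sin (thetaD P G f + ψ) =
      thrustNew P f (thetaD P G f + e) * Real.sin (thetaD P G f + e) := by
  simp only [thrustNew_mul_sin]
  obtain ⟨h1, h2⟩ := abs_le.1 hf
  rcases lt_trichotomy f 0 with h | rfl | h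
  · obtain ⟨ψ, hψ, heq⟩ := exists_feedForward_of_pos P G (f := -f) (-e) (by linarith) (by linarith)
    refine ⟨-ψ, by simpa using hψ, ?_⟩
    rw [thetaD_neg, Real.sin_neg, ← neg_add, Real.sin_neg, mul_neg, clampZero_neg, neg_div_neg_eq,
      show -thetaD P G f + ψ = -(thetaD P G f + -ψ) by ring, Real.sin_neg] at heq
    rw [thrustOld, if_neg h.ne]
    linarith
  · exact ⟨0, by simp, by simp [thetaD_zero, clampZero]⟩
  · obtain ⟨ψ, hψ, heq⟩ := exists_feedForward_of_pos P G e h h2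
    exact ⟨ψ, hψ, by rw [thrustOld, if_neg h.ne', heq]⟩

end FeedForward

section Reference

variable (P : Plant)

theorem Plant.Ma_pos : 0 < P.Ma := by
  have h1 := P.mb_pos
  have h2 := P.ma_pos
  have h3 := P.dG_pos
  have h4 := P.L_pos
  rw [Plant.Ma]
  positivity

/-- The gravity load at an admissible inclination is less than the maximal thrust. -/
theorem abs_gravity_lt {αd : ℝ} (h : αd ∈ Ioo P.αmin P.αmax) :
    |P.Ma * P.L * P.g * Real.cos αd| < P.Tmax * P.L := by
  have hM := P.Ma_pos
  have hg := P.g_pos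
  have hL := P.L_pos
  have hT := P.Tmax_pos
  have hMg : 0 < P.Ma * P.g := by positivity
  suffices hc : |Real.cos αd| * (P.Ma * P.g) < P.Tmax by
    rw [abs_mul, abs_of_pos (by positivity : 0 < P.Ma * P.L * P.g)]
    have := mul_lt_mul_of_pos_right hc hL
    linarith
  rw [Plant.αmin, Plant.αmax] at h
  split_ifs at h with hle
  · have h1 : Real.cos αd < 1 := by
      have := Real.cos_lt_cos_of_nonneg_of_le_pi le_rfl h.2.le h.1
      rwa [Real.cos_zero] at this
    have h2 : -1 < Real.cos αd := by
      have := Real.cos_lt_cos_of_nonneg_of_le_pi h.1.le le_rfl h.2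
      rwa [Real.cos_pi] at this
    have h3 : |Real.cos αd| < 1 := abs_lt.2 ⟨h2, h1⟩
    have := mul_lt_mul_of_pos_right h3 hMg
    linarith
  · have hlt : P.Tmax / (P.Ma * P.g) < 1 := (div_lt_one hMg).2 (not_le.1 hle)
    have hpos : 0 < P.Tmax / (P.Ma * P.g) := by positivity
    have h0 : 0 ≤ αd := (Real.arccos_nonneg _).trans h.1.le
    have hpi : αd ≤ Real.pi := h.2.le.trans (Real.arccos_le_pi _)
    have h1 := Real.cos_lt_cos_of_nonneg_of_le_pi (Real.arccos_nonneg _) hpi h.1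
    have h2 := Real.cos_lt_cos_of_nonneg_of_le_pi h0 (Real.arccos_le_pi _) h.2
    rw [Real.cos_arccos (by linarith) hlt.le] at h1
    rw [Real.cos_arccos (by rw [neg_div]; linarith) (by rw [neg_div]; linarith), neg_div] at h2
    rw [← lt_div_iff₀ hMg]
    exact abs_lt.2 ⟨h2, h1⟩

theorem Plant.I₀_mul_L : P.I₀ * P.L = P.mb * P.dG ^ 2 + P.Ib + P.ma * P.L ^ 2 := by
  have := P.L_pos.ne'
  rw [Plant.I₀]
  field_simp

theorem Plant.Ma_mul_L : P.Ma * P.L = P.mb * P.dG + P.ma * P.L := by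
  have := P.L_pos.ne'
  rw [Plant.Ma]
  field_simp

theorem Plant.Mt_pos : 0 < P.Mt := by
  have h1 := P.mb_pos
  have h2 := P.ma_pos
  have h3 := P.ms_pos
  rw [Plant.Mt]
  positivity

theorem Plant.I₀_mul_L_pos : 0 < P.I₀ * P.L := by
  have h1 := P.mb_pos
  have h2 := P.ma_pos
  have h3 := P.Ib_pos
  rw [Plant.I₀_mul_L]
  positivity

theorem Plant.sq_Ma_mul_L_lt : (P.Ma * P.L) ^ 2 < P.Mt * (P.I₀ * P.L) := by
  have h1 := P.mb_pos
  have h2 := P.ma_pos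
  have h3 := P.Ib_pos
  have h4 := P.ms_pos
  rw [Plant.I₀_mul_L, Plant.Ma_mul_L, Plant.Mt]
  have h5 : 0 ≤ P.mb * P.ma * (P.dG - P.L) ^ 2 := by positivity
  have h6 : 0 < P.ms * (P.mb * P.dG ^ 2 + P.Ib + P.ma * P.L ^ 2) + (P.mb + P.ma) * P.Ib := by
    positivity
  linarith

theorem Plant.sq_coupling_lt (α : ℝ) : (P.Ma * P.L * Real.sin α) ^ 2 < P.Mt * (P.I₀ * P.L) := by
  refine lt_of_le_of_lt ?_ P.sq_Ma_mul_L_lt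
  rw [mul_pow]
  exact mul_le_of_le_one_right (sq_nonneg _) (Real.sin_sq_le_one α)

end Reference

end UAVUGV

end

noncomputable section

namespace UAVUGV

section Field

variable (P : Plant) (G : OuterGains)

/-- The vector field of the closed loop at the state `q.1`, when `u_n sin θ = q.2.1` and
`θ_d = q.2.2`. -/
def fieldAux (k d xd : ℝ) (q : State × ℝ × ℝ) : State :=
  ![q.1 1,
    (P.I₀ * P.L * (uff G xd q.1 + P.Ma * P.L * (q.1 3 ^ 2 * Real.cos (q.1 2))) +
      P.Ma * P.L * Real.sin (q.1 2) * (q.2.1 - P.Ma * P.L * P.g * Real.cos (q.1 2))) /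
      (P.Mt * (P.I₀ * P.L) - (P.Ma * P.L * Real.sin (q.1 2)) ^ 2),
    q.1 3,
    (P.Ma * P.L * Real.sin (q.1 2) *
        (uff G xd q.1 + P.Ma * P.L * (q.1 3 ^ 2 * Real.cos (q.1 2))) +
      P.Mt * (q.2.1 - P.Ma * P.L * P.g * Real.cos (q.1 2))) /
      (P.Mt * (P.I₀ * P.L) - (P.Ma * P.L * Real.sin (q.1 2)) ^ 2),
    q.1 5,
    (-k * (relAngle q.1 - q.2.2) - d * q.1 5) / P.Ia]

/-- The vector field of the closed loop with `u_n sin θ = F z`. -/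
def field (k d xd αd : ℝ) (F : State → ℝ) (z : State) : State :=
  fieldAux P G k d xd (z, F z, relAngleD P G αd z)

theorem contDiff_fieldAux (k d xd : ℝ) : ContDiff ℝ 1 (fieldAux P G k d xd) := by
  have hdet : ∀ α : ℝ, P.Mt * (P.I₀ * P.L) - (P.Ma * P.L * Real.sin α) ^ 2 ≠ 0 := fun α =>
    (sub_pos.2 (P.sq_coupling_lt α)).ne'
  have hz : ∀ i : Fin 6, ContDiff ℝ 1 fun q : State × ℝ × ℝ => q.1 i := fun i =>
    (contDiff_apply ℝ ℝ i).comp contDiff_fst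
  have hF : ContDiff ℝ 1 fun q : State × ℝ × ℝ => q.2.1 := contDiff_fst.comp contDiff_snd
  have hθ : ContDiff ℝ 1 fun q : State × ℝ × ℝ => q.2.2 := contDiff_snd.comp contDiff_snd
  have hs : ContDiff ℝ 1 fun q : State × ℝ × ℝ => P.Ma * P.L * Real.sin (q.1 2) :=
    contDiff_const.mul (hz 2).sin
  have hΔ : ContDiff ℝ 1 fun q : State × ℝ × ℝ =>
      P.Mt * (P.I₀ * P.L) - (P.Ma * P.L * Real.sin (q.1 2)) ^ 2 :=
    contDiff_const.sub (hs.pow 2)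
  have hu : ContDiff ℝ 1 fun q : State × ℝ × ℝ =>
      uff G xd q.1 + P.Ma * P.L * (q.1 3 ^ 2 * Real.cos (q.1 2)) :=
    ((contDiff_const.mul (contDiff_const.sub (hz 0))).sub (contDiff_const.mul (hz 1))).add
      (contDiff_const.mul (((hz 3).pow 2).mul (hz 2).cos))
  have hg : ContDiff ℝ 1 fun q : State × ℝ × ℝ =>
      q.2.1 - P.Ma * P.L * P.g * Real.cos (q.1 2) :=
    hF.sub (contDiff_const.mul (hz 2).cos)
  rw [contDiff_pi]
  intro i
  fin_cases i
  · exact hz 1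
  · exact ((contDiff_const.mul hu).add (hs.mul hg)).div hΔ fun q => hdet _
  · exact hz 3
  · exact ((hs.mul hu).add (contDiff_const.mul hg)).div hΔ fun q => hdet _
  · exact hz 5
  · exact ((contDiff_const.mul (((hz 4).sub (hz 2)).sub hθ)).sub
      (contDiff_const.mul (hz 5))).div_const _

theorem contDiff_tangentialForce (αd : ℝ) : ContDiff ℝ 1 (tangentialForce P G αd) := by
  have hz : ∀ i : Fin 6, ContDiff ℝ 1 fun z : State => z i := contDiff_apply ℝ ℝ
  exact ((contDiff_const.mul (contDiff_const.sub (hz 2))).sub (contDiff_const.mul (hz 3))).add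
    (contDiff_const.mul (hz 2).cos)

theorem contDiff_relAngle : ContDiff ℝ 1 relAngle :=
  (contDiff_apply ℝ ℝ 4).sub (contDiff_apply ℝ ℝ 2)

theorem locallyLipschitz_relAngleD (αd : ℝ) : LocallyLipschitz (relAngleD P G αd) := by
  have hpi : (0 : ℝ) ≤ Real.pi / 2 := by positivity
  have h : LocallyLipschitz fun z => gam P G * Real.arctan (G.ε * tangentialForce P G αd z) :=
    ContDiff.locallyLipschitz (𝕂 := ℝ)
      (contDiff_const.mul (contDiff_const.mul (contDiff_tangentialForce P G αd)).arctan)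
  have h2 := (h.const_min (Real.pi / 2)).const_max (-(Real.pi / 2))
  have h3 : relAngleD P G αd = fun z => max (-(Real.pi / 2))
      (min (Real.pi / 2) (gam P G * Real.arctan (G.ε * tangentialForce P G αd z))) := by
    funext z
    exact sat_eq_max_min hpi _
  rwa [h3]

theorem forceNew_eq (αd : ℝ) (z : State) : forceNew P G αd z =
    clampZero (tangentialForce P G αd z) (P.Tmax * P.L * Real.sin (relAngle z)) :=
  thrustNew_mul_sin P _ _

theorem locallyLipschitz_forceNew (αd : ℝ) : LocallyLipschitz (forceNew P G αd) := by
  have h1 : LocallyLipschitz (tangentialForce P G αd) :=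
    (contDiff_tangentialForce P G αd).locallyLipschitz
  have h2 : LocallyLipschitz fun z : State => P.Tmax * P.L * Real.sin (relAngle z) :=
    ContDiff.locallyLipschitz (𝕂 := ℝ) (contDiff_const.mul contDiff_relAngle.sin)
  rw [funext (forceNew_eq P G αd)]
  exact locallyLipschitz_clampZero h1 h2

theorem locallyLipschitz_field (k d xd αd : ℝ) :
    LocallyLipschitz (field P G k d xd αd (forceNew P G αd)) :=
  (contDiff_fieldAux P G k d xd).locallyLipschitz.comp
    (LocallyLipschitz.id.prodMk
      ((locallyLipschitz_forceNew P G αd).prodMk (locallyLipschitz_relAngleD P G αd)))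

theorem closedLoop_iff (k d xd αd : ℝ) (F : State → ℝ) (z w : State) :
    ClosedLoop P G k d xd αd F z w ↔ w = field P G k d xd αd F z := by
  have hΔ : P.Mt * (P.I₀ * P.L) - (P.Ma * P.L * Real.sin (z 2)) ^ 2 ≠ 0 :=
    (sub_pos.2 (P.sq_coupling_lt (z 2))).ne'
  have hI := P.Ia_pos.ne'
  constructor
  · rintro ⟨h0, h2, h4, h1, h3, h5⟩
    funext i
    fin_cases i
    · exact h0
    · refine (eq_div_iff hΔ).2 ?_
      change w 1 * _ = _
      linear_combination P.I₀ * P.L * h1 + P.Ma * P.L * Real.sin (z 2) * h3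
    · exact h2
    · refine (eq_div_iff hΔ).2 ?_
      change w 3 * _ = _
      linear_combination P.Ma * P.L * Real.sin (z 2) * h1 + P.Mt * h3
    · exact h4
    · refine (eq_div_iff hI).2 ?_
      change w 5 * _ = _
      rw [u₂, attError] at h5
      linear_combination h5
  · intro hw
    have h1 : w 1 * (P.Mt * (P.I₀ * P.L) - (P.Ma * P.L * Real.sin (z 2)) ^ 2) = _ :=
      (eq_div_iff hΔ).1 (congrFun hw 1)
    have h3 : w 3 * (P.Mt * (P.I₀ * P.L) - (P.Ma * P.L * Real.sin (z 2)) ^ 2) = _ :=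
      (eq_div_iff hΔ).1 (congrFun hw 3)
    have h5 : w 5 * P.Ia = _ := (eq_div_iff hI).1 (congrFun hw 5)
    refine ⟨congrFun hw 0, congrFun hw 2, congrFun hw 4, ?_, ?_, ?_⟩
    · refine mul_right_cancel₀ hΔ ?_
      linear_combination P.Mt * h1 - P.Ma * P.L * Real.sin (z 2) * h3
    · refine mul_right_cancel₀ hΔ ?_
      linear_combination P.I₀ * P.L * h3 - P.Ma * P.L * Real.sin (z 2) * h1
    · rw [u₂, attError]
      linear_combination h5

end Field

section Equilibrium

variable (P : Plant) (G : OuterGains)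

theorem tangentialForce_equilibrium (xd αd : ℝ) :
    tangentialForce P G αd (equilibrium P G xd αd) = P.Ma * P.L * P.g * Real.cos αd := by
  simp [tangentialForce, equilibrium]

theorem relAngle_equilibrium (xd αd : ℝ) : relAngle (equilibrium P G xd αd) =
    thetaD P G (P.Ma * P.L * P.g * Real.cos αd) := by
  simp [relAngle, equilibrium]

theorem relAngleD_equilibrium (xd αd : ℝ) : relAngleD P G αd (equilibrium P G xd αd) =
    thetaD P G (P.Ma * P.L * P.g * Real.cos αd) := by
  rw [relAngleD, tangentialForce_equilibrium]

theorem eventually_abs_tangentialForce_lt (xd : ℝ) {αd : ℝ} (h : αd ∈ Ioo P.αmin P.αmax) :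
    ∀ᶠ z in 𝓝 (equilibrium P G xd αd), |tangentialForce P G αd z| < P.Tmax * P.L := by
  have hc : Continuous fun z => |tangentialForce P G αd z| :=
    (contDiff_tangentialForce P G αd).continuous.abs
  refine hc.continuousAt.eventually_lt continuousAt_const ?_
  rw [tangentialForce_equilibrium]
  exact abs_gravity_lt P h

theorem field_equilibrium (k d xd : ℝ) {αd : ℝ} (h : αd ∈ Ioo P.αmin P.αmax) :
    field P G k d xd αd (forceNew P G αd) (equilibrium P G xd αd) = 0 := by
  symm
  rw [← closedLoop_iff]
  refine ⟨?_, ?_, ?_, ?_, ?_, ?_⟩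
  · simp [equilibrium]
  · simp [equilibrium]
  · simp [equilibrium]
  · simp [equilibrium, uff]
  · rw [forceNew_eq, tangentialForce_equilibrium, relAngle_equilibrium,
      clampZero_sin_thetaD P G (abs_gravity_lt P h).le]
    simp [equilibrium]
    ring
  · rw [u₂, attError, relAngle_equilibrium, relAngleD_equilibrium]
    simp [equilibrium]

theorem eventually_abs_forceNew_sub_le (xd : ℝ) {αd : ℝ} (h : αd ∈ Ioo P.αmin P.αmax) :
    ∀ᶠ z in 𝓝 (equilibrium P G xd αd), |forceNew P G αd z - tangentialForce P G αd z| ≤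
      P.Tmax * P.L * |attError P G αd z| := by
  filter_upwards [eventually_abs_tangentialForce_lt P G xd h] with z hz
  rw [forceNew_eq]
  exact abs_clampZero_sub_le P G hz.le

/-- Away from the vertical, the thrust saturation is inactive near the equilibrium. -/
theorem eventually_forceNew_eq (xd : ℝ) {αd : ℝ} (h : αd ∈ Ioo P.αmin P.αmax)
    (hne : αd ≠ Real.pi / 2) :
    ∀ᶠ z in 𝓝 (equilibrium P G xd αd), forceNew P G αd z = tangentialForce P G αd z := by
  have hlt := abs_lt.1 (abs_gravity_lt P h)
  have hαd : αd ∈ Icc 0 Real.pi := by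
    have h1 := h.1
    have h2 := h.2
    rw [Plant.αmin] at h1
    rw [Plant.αmax] at h2
    split_ifs at h1 h2
    · exact ⟨h1.le, h2.le⟩
    · exact ⟨(Real.arccos_nonneg _).trans h1.le, h2.le.trans (Real.arccos_le_pi _)⟩
  have hcos : Real.cos αd ≠ 0 := by
    intro h0
    refine hne (Real.injOn_cos hαd ⟨by positivity, by linarith [Real.pi_pos]⟩ ?_)
    rw [h0, Real.cos_pi_div_two]
  have hpos : 0 < P.Ma * P.L * P.g := mul_pos (mul_pos P.Ma_pos P.L_pos) P.g_pos
  have hcf : Continuous (tangentialForce P G αd) := (contDiff_tangentialForce P G αd).continuous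
  have hcs : Continuous fun z : State => P.Tmax * P.L * Real.sin (relAngle z) :=
    continuous_const.mul (Real.continuous_sin.comp contDiff_relAngle.continuous)
  simp only [forceNew_eq]
  rcases hcos.lt_or_gt with hc | hc
  · have hf := mul_neg_of_pos_of_neg hpos hc
    have h1 : ∀ᶠ z in 𝓝 (equilibrium P G xd αd), tangentialForce P G αd z < 0 :=
      hcf.continuousAt.eventually_lt continuousAt_const (by rwa [tangentialForce_equilibrium])
    have h2 : ∀ᶠ z in 𝓝 (equilibrium P G xd αd),
        P.Tmax * P.L * Real.sin (relAngle z) < tangentialForce P G αd z := by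
      refine hcs.continuousAt.eventually_lt hcf.continuousAt ?_
      rw [tangentialForce_equilibrium, relAngle_equilibrium]
      have := lt_mul_sin_thetaD P G (neg_pos.2 hf) (by linarith [hlt.1])
      rw [thetaD_neg, Real.sin_neg] at this
      linarith
    filter_upwards [h1, h2] with z hz1 hz2
    have := clampZero_of_le (neg_nonneg.2 hz1.le) (neg_le_neg hz2.le)
    rw [clampZero_neg] at this
    linarith
  · have hf := mul_pos hpos hc
    have h1 : ∀ᶠ z in 𝓝 (equilibrium P G xd αd), 0 < tangentialForce P G αd z :=
      continuousAt_const.eventually_lt hcf.continuousAt (by rwa [tangentialForce_equilibrium])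
    have h2 : ∀ᶠ z in 𝓝 (equilibrium P G xd αd),
        tangentialForce P G αd z < P.Tmax * P.L * Real.sin (relAngle z) := by
      refine hcf.continuousAt.eventually_lt hcs.continuousAt ?_
      rw [tangentialForce_equilibrium, relAngle_equilibrium]
      exact lt_mul_sin_thetaD P G hf hlt.2
    filter_upwards [h1, h2] with z hz1 hz2
    exact clampZero_of_le hz1.le hz2.le

/-- Slope of the attitude mapping at the steady-state tangential force. -/
def thetaSlope (αd : ℝ) : ℝ :=
  gam P G * (1 / (1 + (G.ε * (P.Ma * P.L * P.g * Real.cos αd)) ^ 2) * G.ε)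

/-- Linearization at the equilibrium of the attitude error. -/
def attErrorLin (xd αd : ℝ) (z : State) : ℝ :=
  (z 4 - equilibrium P G xd αd 4) - (z 2 - αd) + thetaSlope P G αd *
    ((G.kpα + P.Ma * P.L * P.g * Real.sin αd) * (z 2 - αd) + G.kvα * z 3)

theorem hasDerivAt_thetaD {αd : ℝ} (h : αd ∈ Ioo P.αmin P.αmax) :
    HasDerivAt (thetaD P G) (thetaSlope P G αd) (P.Ma * P.L * P.g * Real.cos αd) := by
  have h1 : HasDerivAt (fun f => gam P G * Real.arctan (G.ε * f)) (thetaSlope P G αd)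
      (P.Ma * P.L * P.g * Real.cos αd) := by
    have := ((hasDerivAt_id (P.Ma * P.L * P.g * Real.cos αd)).const_mul G.ε).arctan.const_mul
      (gam P G)
    simpa [thetaSlope] using this
  refine h1.congr_of_eventuallyEq ?_
  filter_upwards [continuous_abs.continuousAt.eventually (gt_mem_nhds (abs_gravity_lt P h))]
    with f hf
  exact thetaD_of_abs_le P G (le_of_lt hf)

theorem eventually_abs_attError_sub_le (xd : ℝ) {αd : ℝ} (h : αd ∈ Ioo P.αmin P.αmax) {η : ℝ}
    (hη : 0 < η) : ∀ᶠ z in 𝓝 (equilibrium P G xd αd),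
      |attError P G αd z - attErrorLin P G xd αd z| ≤ η * ‖z - equilibrium P G xd αd‖ := by
  set p := equilibrium P G xd αd with hp
  have hp2 : p 2 = αd := by simp [hp, equilibrium]
  have hp3 : p 3 = 0 := by simp [hp, equilibrium]
  have hp4 : p 4 = αd + thetaD P G (P.Ma * P.L * P.g * Real.cos αd) := by simp [hp, equilibrium]
  have hf : HasFDerivAt (tangentialForce P G αd) _ p :=
    ((((hasFDerivAt_const αd p).sub (hasFDerivAt_apply 2 p)).const_mul G.kpα).sub
      ((hasFDerivAt_apply 3 p).const_mul G.kvα)).add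
      ((hasFDerivAt_apply 2 p).cos.const_mul (P.Ma * P.L * P.g))
  have hθ : HasDerivAt (thetaD P G) (thetaSlope P G αd) (tangentialForce P G αd p) := by
    rw [hp, tangentialForce_equilibrium]
    exact hasDerivAt_thetaD P G h
  have hcomp := (hθ.comp_hasFDerivAt p hf).isLittleO.def hη
  filter_upwards [hcomp] with z hz
  rw [Real.norm_eq_abs] at hz
  refine le_trans (le_of_eq ?_) hz
  rw [← abs_neg]
  congr 1
  simp only [Function.comp_apply, attError, attErrorLin, relAngle, relAngleD, ← hp]
  rw [hp4, hp, tangentialForce_equilibrium, ← hp]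
  simp [hp2, hp3]
  ring

end Equilibrium

end UAVUGV

end

noncomputable section

namespace UAVUGV

section Linearization

variable (P : Plant) (G : OuterGains)

/-- Size of the position and velocity errors of the outer loop. -/
def outerSize (xd αd : ℝ) (z : State) : ℝ := |z 0 - xd| + |z 1| + |z 2 - αd| + |z 3|

/-- Size of the state in the coordinates of the linearized closed loop. -/
def errorSize (xd αd : ℝ) (z : State) : ℝ :=
  outerSize xd αd z + |attErrorLin P G xd αd z| + |z 5|

theorem exists_errorSize_bounds (xd αd : ℝ) : ∃ K ≥ 1, ∀ z : State,
    ‖z - equilibrium P G xd αd‖ ≤ K * errorSize P G xd αd z ∧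
      errorSize P G xd αd z ≤ K * ‖z - equilibrium P G xd αd‖ := by
  set κ₁ := thetaSlope P G αd * (G.kpα + P.Ma * P.L * P.g * Real.sin αd) with hκ₁
  set κ₂ := thetaSlope P G αd * G.kvα with hκ₂
  have h1 := abs_nonneg κ₁
  have h2 := abs_nonneg κ₂
  refine ⟨7 + |κ₁| + |κ₂|, by linarith, fun z => ?_⟩
  set p := equilibrium P G xd αd with hp
  have hp0 : p 0 = xd := by simp [hp, equilibrium]
  have hp1 : p 1 = 0 := by simp [hp, equilibrium]
  have hp2 : p 2 = αd := by simp [hp, equilibrium]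
  have hp3 : p 3 = 0 := by simp [hp, equilibrium]
  have hp5 : p 5 = 0 := by simp [hp, equilibrium]
  have hlin : attErrorLin P G xd αd z =
      (z 4 - p 4) - (z 2 - αd) + κ₁ * (z 2 - αd) + κ₂ * z 3 := by
    rw [attErrorLin, hκ₁, hκ₂]
    ring
  have n0 := abs_nonneg (z 0 - xd)
  have n1 := abs_nonneg (z 1)
  have n2 := abs_nonneg (z 2 - αd)
  have n3 := abs_nonneg (z 3)
  have n4 := abs_nonneg (attErrorLin P G xd αd z)
  have n5 := abs_nonneg (z 5)
  have hS : errorSize P G xd αd z = |z 0 - xd| + |z 1| + |z 2 - αd| + |z 3| +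
    |attErrorLin P G xd αd z| + |z 5| := rfl
  have hS0 : 0 ≤ errorSize P G xd αd z := by rw [hS]; positivity
  set S := errorSize P G xd αd z
  have hKS : 0 ≤ (|κ₁| + |κ₂|) * S := by positivity
  have m1 : |κ₁ * (z 2 - αd)| = |κ₁| * |z 2 - αd| := abs_mul _ _
  have m2 : |κ₂ * z 3| = |κ₂| * |z 3| := abs_mul _ _
  constructor
  · refine (pi_norm_le_iff_of_nonneg (by positivity)).2 fun i => ?_
    rw [Pi.sub_apply, Real.norm_eq_abs]
    have h4 : |z 4 - p 4| ≤ (7 + |κ₁| + |κ₂|) * S := by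
      have e : z 4 - p 4 = attErrorLin P G xd αd z + (z 2 - αd) + -(κ₁ * (z 2 - αd)) +
        -(κ₂ * z 3) := by rw [hlin]; ring
      have t1 := abs_add_le (attErrorLin P G xd αd z + (z 2 - αd) + -(κ₁ * (z 2 - αd)))
        (-(κ₂ * z 3))
      have t2 := abs_add_le (attErrorLin P G xd αd z + (z 2 - αd)) (-(κ₁ * (z 2 - αd)))
      have t3 := abs_add_le (attErrorLin P G xd αd z) (z 2 - αd)
      rw [abs_neg, m2] at t1
      rw [abs_neg, m1] at t2
      have t4 : |κ₁| * |z 2 - αd| ≤ |κ₁| * S := by gcongr; linarith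
      have t5 : |κ₂| * |z 3| ≤ |κ₂| * S := by gcongr; linarith
      rw [e]
      linarith
    fin_cases i
    · change |z 0 - p 0| ≤ _; rw [hp0]; linarith
    · change |z 1 - p 1| ≤ _; rw [hp1, sub_zero]; linarith
    · change |z 2 - p 2| ≤ _; rw [hp2]; linarith
    · change |z 3 - p 3| ≤ _; rw [hp3, sub_zero]; linarith
    · exact h4
    · change |z 5 - p 5| ≤ _; rw [hp5, sub_zero]; linarith
  · set Y := ‖z - p‖
    have hY : ∀ i, |z i - p i| ≤ Y := fun i => by
      simpa [Real.norm_eq_abs] using norm_le_pi_norm (z - p) i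
    have y0 := hY 0
    have y1 := hY 1
    have y2 := hY 2
    have y3 := hY 3
    have y4 := hY 4
    have y5 := hY 5
    rw [hp0] at y0
    rw [hp1, sub_zero] at y1
    rw [hp2] at y2
    rw [hp3, sub_zero] at y3
    rw [hp5, sub_zero] at y5
    have t1 := abs_add_le ((z 4 - p 4) - (z 2 - αd) + κ₁ * (z 2 - αd)) (κ₂ * z 3)
    have t2 := abs_add_le ((z 4 - p 4) - (z 2 - αd)) (κ₁ * (z 2 - αd))
    have t3 := abs_sub (z 4 - p 4) (z 2 - αd)
    rw [m2] at t1
    rw [m1] at t2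
    have t4 : |κ₁| * |z 2 - αd| ≤ |κ₁| * Y := by gcongr
    have t5 : |κ₂| * |z 3| ≤ |κ₂| * Y := by gcongr
    rw [← hlin] at t1
    rw [hS]
    linarith

/-- The closed loop equations, up to small errors, are those of the linearized outer loop. -/
theorem eventually_residual_le (k d xd : ℝ) {αd : ℝ} (h : αd ∈ Ioo P.αmin P.αmax) {η : ℝ}
    (hη : 0 < η) : ∀ᶠ z in 𝓝 (equilibrium P G xd αd),
      |P.Ma * P.L * ((Real.sin (z 2) - Real.sin αd) *
          field P G k d xd αd (forceNew P G αd) z 3 + z 3 ^ 2 * Real.cos (z 2))| ≤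
        η * ‖z - equilibrium P G xd αd‖ ∧
      |P.Ma * P.L * ((Real.sin (z 2) - Real.sin αd) *
          field P G k d xd αd (forceNew P G αd) z 1)| ≤
        η * ‖z - equilibrium P G xd αd‖ := by
  set p := equilibrium P G xd αd with hp
  set v := field P G k d xd αd (forceNew P G αd) with hv
  have hp2 : p 2 = αd := by simp [hp, equilibrium]
  have hp3 : p 3 = 0 := by simp [hp, equilibrium]
  have hvp : v p = 0 := field_equilibrium P G k d xd h
  obtain ⟨K, s, hs, hK⟩ := locallyLipschitz_field P G k d xd αd p
  have hml : 0 < P.Ma * P.L := mul_pos P.Ma_pos P.L_pos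
  have hK0 : (0 : ℝ) ≤ K := K.2
  have hsmall : ∀ᶠ z in 𝓝 p, P.Ma * P.L * (K + 1) * ‖z - p‖ < η := by
    have hc : Continuous fun z : State => P.Ma * P.L * (K + 1) * ‖z - p‖ := by fun_prop
    exact hc.continuousAt.eventually_lt continuousAt_const (by simpa using hη)
  filter_upwards [hs, hsmall] with z hz hzη
  have hw : ‖v z‖ ≤ K * ‖z - p‖ := by
    have := hK.dist_le_mul z hz p (mem_of_mem_nhds hs)
    rwa [← hv, hvp, dist_zero_right, dist_eq_norm] at this
  set Y := ‖z - p‖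
  have hY0 : 0 ≤ Y := norm_nonneg _
  have hwi : ∀ i, |v z i| ≤ K * Y := fun i => (norm_le_pi_norm (v z) i).trans hw
  have hY : ∀ i, |z i - p i| ≤ Y := fun i => by
    simpa [Real.norm_eq_abs] using norm_le_pi_norm (z - p) i
  have y3 := hY 3
  rw [hp3, sub_zero] at y3
  have hsin : |Real.sin (z 2) - Real.sin αd| ≤ Y := by
    have h1 := Real.lipschitzWith_sin.dist_le_mul (z 2) αd
    rw [Real.dist_eq, Real.dist_eq, NNReal.coe_one, one_mul] at h1
    have h2 := hY 2
    rw [hp2] at h2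
    exact h1.trans h2
  have hprod : ∀ i, |(Real.sin (z 2) - Real.sin αd) * v z i| ≤ Y * (K * Y) := fun i => by
    rw [abs_mul]
    exact mul_le_mul hsin (hwi i) (abs_nonneg _) hY0
  have hsq : |z 3 ^ 2 * Real.cos (z 2)| ≤ Y ^ 2 := by
    rw [abs_mul, abs_pow]
    calc |z 3| ^ 2 * |Real.cos (z 2)| ≤ Y ^ 2 * 1 := by
          gcongr
          exact Real.abs_cos_le_one _
      _ = Y ^ 2 := mul_one _
  have hfin := mul_le_mul_of_nonneg_right hzη.le hY0
  have hY2 : 0 ≤ P.Ma * P.L * Y ^ 2 := by positivity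
  constructor
  · rw [abs_mul, abs_of_pos hml]
    have h1 := (abs_add_le _ _).trans (add_le_add (hprod 3) hsq)
    have h2 := mul_le_mul_of_nonneg_left h1 hml.le
    linarith
  · rw [abs_mul, abs_of_pos hml]
    have h2 := mul_le_mul_of_nonneg_left (hprod 1) hml.le
    linarith

end Linearization

section Acceleration

/-- The accelerations of a planar mechanical system are bounded by its state and forces. -/
theorem exists_abs_acceleration_le {M J m : ℝ} (hM : 0 < M) (hdet : m ^ 2 < M * J)
    (k₁ k₂ d₁ d₂ : ℝ) : ∃ R ≥ 0, ∀ q₁ v₁ q₂ v₂ w₁ w₂ f₁ f₂ : ℝ,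
      M * w₁ - m * w₂ = -k₁ * q₁ - d₁ * v₁ + f₁ → J * w₂ - m * w₁ = -k₂ * q₂ - d₂ * v₂ + f₂ →
      |w₂| ≤ R * (|q₁| + |v₁| + |q₂| + |v₂| + (|f₁| + |f₂|)) := by
  have hΔ : 0 < M * J - m ^ 2 := sub_pos.2 hdet
  set A := |k₁| + |k₂| + |d₁| + |d₂| + 1 with hA
  have a1 := abs_nonneg k₁
  have a2 := abs_nonneg k₂
  have a3 := abs_nonneg d₁
  have a4 := abs_nonneg d₂
  have hA0 : 0 ≤ A := by positivity
  refine ⟨(M + |m|) * A / (M * J - m ^ 2), by positivity, ?_⟩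
  intro q₁ v₁ q₂ v₂ w₁ w₂ f₁ f₂ h1 h2
  set S := |q₁| + |v₁| + |q₂| + |v₂| + (|f₁| + |f₂|) with hS
  have b1 := abs_nonneg q₁
  have b2 := abs_nonneg v₁
  have b3 := abs_nonneg q₂
  have b4 := abs_nonneg v₂
  have b5 := abs_nonneg f₁
  have b6 := abs_nonneg f₂
  have hbound : ∀ k q d v f : ℝ, |k| + |d| + 1 ≤ A → |q| ≤ S → |v| ≤ S → |f| ≤ S →
      |-k * q - d * v + f| ≤ A * S := by
    intro k q d v f hk hq hv hf
    have t1 := abs_add_le (-k * q - d * v) f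
    have t2 := abs_sub (-k * q) (d * v)
    rw [abs_mul, abs_mul, abs_neg] at t2
    have t3 : |k| * |q| ≤ |k| * S := by gcongr
    have t4 : |d| * |v| ≤ |d| * S := by gcongr
    have t5 : (|k| + |d| + 1) * S ≤ A * S := mul_le_mul_of_nonneg_right hk ((abs_nonneg _).trans hq)
    linarith
  have g1 := hbound k₁ q₁ d₁ v₁ f₁ (by linarith) (by linarith) (by linarith) (by linarith)
  have g2 := hbound k₂ q₂ d₂ v₂ f₂ (by linarith) (by linarith) (by linarith) (by linarith)
  rw [← h1] at g1
  rw [← h2] at g2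
  have hid : w₂ * (M * J - m ^ 2) = M * (J * w₂ - m * w₁) + m * (M * w₁ - m * w₂) := by ring
  rw [div_mul_eq_mul_div, le_div_iff₀ hΔ]
  calc |w₂| * (M * J - m ^ 2) = |w₂ * (M * J - m ^ 2)| := by rw [abs_mul, abs_of_pos hΔ]
    _ ≤ |M * (J * w₂ - m * w₁)| + |m * (M * w₁ - m * w₂)| := by rw [hid]; exact abs_add_le _ _
    _ ≤ M * (A * S) + |m| * (A * S) := by
        rw [abs_mul, abs_mul, abs_of_pos hM]
        gcongr
    _ = (M + |m|) * A * S := by ring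

end Acceleration

section LyapunovFunction

variable (P : Plant) (G : OuterGains)

/-- Lyapunov function of the closed loop. -/
def totalEnergy (k c μ h xd αd : ℝ) (z : State) : ℝ :=
  outerEnergy P.Mt (P.I₀ * P.L) (P.Ma * P.L * Real.sin αd) G.kpx G.kpα c
      (z 0 - xd) (z 1) (z 2 - αd) (z 3) +
    h * innerEnergy k P.Ia μ (attErrorLin P G xd αd z) (z 5)

/-- Derivative of `totalEnergy` at `z` in the direction `w`. -/
def totalEnergyDeriv (k c μ h xd αd : ℝ) (z w : State) : ℝ :=
  outerEnergyDeriv P.Mt (P.I₀ * P.L) (P.Ma * P.L * Real.sin αd) G.kpx G.kpα c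
      (z 0 - xd) (z 1) (z 2 - αd) (z 3) (w 0) (w 1) (w 2) (w 3) +
    h * innerEnergyDeriv k P.Ia μ (attErrorLin P G xd αd z) (z 5)
      (w 4 - w 2 + thetaSlope P G αd *
        ((G.kpα + P.Ma * P.L * P.g * Real.sin αd) * w 2 + G.kvα * w 3)) (w 5)

theorem continuous_totalEnergy (k c μ h xd αd : ℝ) :
    Continuous (totalEnergy P G k c μ h xd αd) := by
  unfold totalEnergy outerEnergy innerEnergy attErrorLin
  fun_prop

theorem HasDerivWithinAt.outerEnergy {M J m k₁ k₂ c p₁ w₁ p₂ w₂ : ℝ} {q₁ v₁ q₂ v₂ : ℝ → ℝ}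
    {I : Set ℝ} {t : ℝ} (h₁ : HasDerivWithinAt q₁ p₁ I t) (h₂ : HasDerivWithinAt v₁ w₁ I t)
    (h₃ : HasDerivWithinAt q₂ p₂ I t) (h₄ : HasDerivWithinAt v₂ w₂ I t) :
    HasDerivWithinAt (fun s => outerEnergy M J m k₁ k₂ c (q₁ s) (v₁ s) (q₂ s) (v₂ s))
      (outerEnergyDeriv M J m k₁ k₂ c (q₁ t) (v₁ t) (q₂ t) (v₂ t) p₁ w₁ p₂ w₂) I t := by
  have h := ((((((h₂.pow 2).const_mul M).sub ((h₂.mul h₄).const_mul (2 * m))).add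
    ((h₄.pow 2).const_mul J)).div_const 2).add
    ((((h₁.pow 2).const_mul k₁).add ((h₃.pow 2).const_mul k₂)).div_const 2)).add
    (((h₁.mul ((h₂.const_mul M).sub (h₄.const_mul m))).add
      (h₃.mul ((h₄.const_mul J).sub (h₂.const_mul m)))).const_mul c)
  refine h.congr_deriv ?_
  simp only [outerEnergyDeriv, Pi.sub_apply]
  norm_num
  ring

theorem HasDerivWithinAt.innerEnergy {k J μ e₁ ν₁ : ℝ} {e ν : ℝ → ℝ}
    {I : Set ℝ} {t : ℝ} (h₁ : HasDerivWithinAt e e₁ I t) (h₂ : HasDerivWithinAt ν ν₁ I t) :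
    HasDerivWithinAt (fun s => innerEnergy k J μ (e s) (ν s))
      (innerEnergyDeriv k J μ (e t) (ν t) e₁ ν₁) I t := by
  have h := ((((h₁.pow 2).const_mul k).add ((h₂.pow 2).const_mul J)).div_const 2).add
    ((h₁.mul h₂).const_mul (μ * J))
  refine h.congr_deriv ?_
  simp only [innerEnergyDeriv]
  norm_num
  ring

theorem hasDerivWithinAt_totalEnergy (k c μ h xd αd : ℝ) (z : ℝ → State) (I : Set ℝ) (t : ℝ)
    (w : State) (hz : HasDerivWithinAt z w I t) :
    HasDerivWithinAt (fun s => totalEnergy P G k c μ h xd αd (z s))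
      (totalEnergyDeriv P G k c μ h xd αd (z t) w) I t := by
  have hi := hasDerivWithinAt_pi.1 hz
  have h2 := (hi 2).sub_const αd
  exact (HasDerivWithinAt.outerEnergy ((hi 0).sub_const xd) (hi 1) h2 (hi 3)).add
    ((HasDerivWithinAt.innerEnergy ((((hi 4).sub_const _).sub h2).add
      (((h2.const_mul _).add ((hi 3).const_mul _)).const_mul _)) (hi 5)).const_mul h)

/-- A gain condition that implies asymptotic stability, for any local bound of the force error by
the attitude error. -/
theorem exists_stability_constants (xd : ℝ) {αd : ℝ} (hαd : αd ∈ Ioo P.αmin P.αmax) :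
    ∃ a > 0, ∃ b ≥ 0, ∃ R ≥ 0, ∀ T ≥ 0,
      (∀ᶠ z in 𝓝 (equilibrium P G xd αd), |forceNew P G αd z - tangentialForce P G αd z| ≤
        T * |attError P G αd z|) →
      ∀ k d : ℝ, 0 < d → GainCondition a (b * T) R (R * T) P.Ia k d →
        AsymptoticallyStable (ClosedLoop P G k d xd αd (forceNew P G αd))
          (equilibrium P G xd αd) := by
  have hkpα := G.kpα_pos
  have hkvα := G.kvα_pos
  have hkpx := hkpα.trans G.kpα_lt_kpx
  have hkvx := hkvα.trans G.kvα_lt_kvx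
  set m := P.Ma * P.L * Real.sin αd with hm
  have hdet : m ^ 2 < P.Mt * (P.I₀ * P.L) := P.sq_coupling_lt αd
  obtain ⟨c, hc, a, ha, b, hb, lo, hlo, hi, hhi, hout⟩ :=
    exists_outerEnergy_bounds P.Mt_pos P.I₀_mul_L_pos hdet hkpx hkpα hkvx hkvα
  obtain ⟨R₀, hR₀, hacc⟩ := exists_abs_acceleration_le P.Mt_pos hdet G.kpx G.kpα G.kvx G.kvα
  set κ := thetaSlope P G αd with hκ
  set k₁ := G.kpα + P.Ma * P.L * P.g * Real.sin αd with hk₁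
  set R := 1 + |κ * k₁| + |κ * G.kvα| * R₀ with hR
  have hR0 : 0 ≤ R := by positivity
  refine ⟨a, ha, b, hb.le, R, hR0, fun T hT hforce k d hd hgain => ?_⟩
  obtain ⟨μ, hμ, h, hh, c₃, hc₃, η, hη, hμk, hdecay⟩ :=
    hgain.exists_decay hb.le hR0 P.Ia_pos hd
  obtain ⟨lo', hlo', hi', hhi', hin⟩ := exists_innerEnergy_bounds P.Ia_pos hμ hμk
  obtain ⟨K, hK, hsize⟩ := exists_errorSize_bounds P G xd αd
  have hK0 : 0 < K := by linarith
  set η' := η / (K * (1 + T)) with hη'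
  have hη'0 : 0 < η' := by positivity
  obtain ⟨r, hr, hball⟩ := Metric.eventually_nhds_iff.1 (hforce.and
    ((eventually_abs_attError_sub_le P G xd hαd hη'0).and
      (eventually_residual_le P G k d xd hαd hη'0)))
  set p := equilibrium P G xd αd with hp
  set v := field P G k d xd αd (forceNew P G αd) with hv
  set l := min lo (h * lo') / 2 with hl
  have hl0 : 0 < l := by positivity
  set u := hi + h * hi' with hu
  have hu0 : 0 < u := by positivity
  have hsize0 : ∀ z, 0 ≤ errorSize P G xd αd z := fun z => by
    unfold errorSize outerSize
    positivity
  have hsq1 : ∀ z, ‖z - p‖ ^ 2 ≤ K ^ 2 * errorSize P G xd αd z ^ 2 := fun z => by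
    rw [← mul_pow]
    exact pow_le_pow_left₀ (norm_nonneg _) (hsize z).1 2
  have hsq2 : ∀ z, errorSize P G xd αd z ^ 2 ≤ K ^ 2 * ‖z - p‖ ^ 2 := fun z => by
    rw [← mul_pow]
    exact pow_le_pow_left₀ (hsize0 z) (hsize z).2 2
  refine asymptoticallyStable_of_lyapunov (v := v)
    (V := totalEnergy P G k c μ h xd αd) (V' := totalEnergyDeriv P G k c μ h xd αd)
    (r := r) (c₁ := l / K ^ 2) (c₂ := u * K ^ 2) (c₃ := c₃ / K ^ 2)
    (closedLoop_iff P G k d xd αd (forceNew P G αd)) (locallyLipschitz_field P G k d xd αd)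
    (field_equilibrium P G k d xd hαd) (continuous_totalEnergy P G k c μ h xd αd)
    (hasDerivWithinAt_totalEnergy P G k c μ h xd αd) hr (by positivity) (by positivity)
    (by positivity) ?_ ?_ ?_
  · intro z _
    have h1 := (hout (z 0 - xd) (z 1) (z 2 - αd) (z 3)).1
    have h2 := mul_le_mul_of_nonneg_left (hin (attErrorLin P G xd αd z) (z 5)).1 hh.le
    have h3 := mul_le_mul_of_nonneg_left (hsq1 z) (by positivity : 0 ≤ l / K ^ 2)
    have h4 : l / K ^ 2 * (K ^ 2 * errorSize P G xd αd z ^ 2) = l * errorSize P G xd αd z ^ 2 := by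
      field_simp
    set X := |z 0 - xd| + |z 1| + |z 2 - αd| + |z 3| with hX
    set N := |attErrorLin P G xd αd z| + |z 5| with hN
    have h5 : errorSize P G xd αd z = X + N := add_assoc _ _ _
    have h6 : l * (X + N) ^ 2 ≤ l * (2 * X ^ 2 + 2 * N ^ 2) := by
      gcongr
      linarith [sq_nonneg (X - N)]
    have h7 : l * 2 * X ^ 2 ≤ lo * X ^ 2 := by
      gcongr
      linarith [min_le_left lo (h * lo')]
    have h8 : l * 2 * N ^ 2 ≤ h * lo' * N ^ 2 :=
      mul_le_mul_of_nonneg_right (by linarith [min_le_right lo (h * lo')]) (sq_nonneg N)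
    rw [h4, h5] at h3
    unfold totalEnergy
    linarith
  · intro z _
    have h1 := (hout (z 0 - xd) (z 1) (z 2 - αd) (z 3)).2.1
    have h2 := mul_le_mul_of_nonneg_left (hin (attErrorLin P G xd αd z) (z 5)).2 hh.le
    have h3 := mul_le_mul_of_nonneg_left (hsq2 z) hu0.le
    set X := |z 0 - xd| + |z 1| + |z 2 - αd| + |z 3| with hX
    set N := |attErrorLin P G xd αd z| + |z 5| with hN
    have hX0 : 0 ≤ X := by positivity
    have hN0 : 0 ≤ N := by positivity
    have h5 : errorSize P G xd αd z = X + N := add_assoc _ _ _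
    have h7 : hi * X ^ 2 ≤ hi * (X + N) ^ 2 := by gcongr; linarith
    have h8 : h * hi' * N ^ 2 ≤ h * hi' * (X + N) ^ 2 := by gcongr; linarith
    rw [h5] at h3
    unfold totalEnergy
    rw [hu] at h3 ⊢
    linarith
  · intro z hz
    obtain ⟨hF, hatt, hr1, hr2⟩ := hball (y := z) (by rwa [dist_eq_norm])
    obtain ⟨hw0, hw2, hw4, hw1, hw3, hw5⟩ :=
      (closedLoop_iff P G k d xd αd (forceNew P G αd) z (v z)).2 rfl
    set r₁ := P.Ma * P.L * ((Real.sin (z 2) - Real.sin αd) * v z 3 + z 3 ^ 2 * Real.cos (z 2))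
      with hr₁
    set r₂ := P.Ma * P.L * ((Real.sin (z 2) - Real.sin αd) * v z 1) with hr₂
    set δ := forceNew P G αd z - tangentialForce P G αd z with hδ
    set e := attErrorLin P G xd αd z with he
    set r₃ := attError P G αd z - e with hr₃
    have heq1 : P.Mt * v z 1 - m * v z 3 = -G.kpx * (z 0 - xd) - G.kvx * z 1 + r₁ := by
      rw [uff] at hw1
      rw [hr₁, hm]
      linear_combination hw1
    have heq2 : P.I₀ * P.L * v z 3 - m * v z 1 =
        -G.kpα * (z 2 - αd) - G.kvα * z 3 + (δ + r₂) := by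
      rw [hr₂, hm, hδ, tangentialForce]
      linear_combination hw3
    have hout' := (hout (z 0 - xd) (z 1) (z 2 - αd) (z 3)).2.2 _ _ _ _ heq1 heq2
    have hacc' := hacc _ _ _ _ _ _ _ _ heq1 heq2
    set X := |z 0 - xd| + |z 1| + |z 2 - αd| + |z 3| with hX
    set D := |r₁| + |δ + r₂| with hD
    have hX0 : 0 ≤ X := by positivity
    have hD0 : 0 ≤ D := by positivity
    set N := X + |e| + |z 5| with hN
    have hN0 : 0 ≤ N := by positivity
    have hNe : errorSize P G xd αd z = N := rfl
    have hη'N : (1 + T) * (η' * ‖z - p‖) ≤ η * N := by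
      calc (1 + T) * (η' * ‖z - p‖) ≤ (1 + T) * (η' * (K * N)) := by
            gcongr
            exact (hsize z).1
        _ = η * N := by rw [hη']; field_simp
    have hsm : 0 ≤ η' * ‖z - p‖ := by positivity
    have hsmT : 0 ≤ T * (η' * ‖z - p‖) := by positivity
    have hδb : |δ| ≤ T * |e| + T * (η' * ‖z - p‖) := by
      have h1 : |attError P G αd z| ≤ |e| + η' * ‖z - p‖ := by
        have : attError P G αd z = e + r₃ := by rw [hr₃]; ring
        rw [this]
        exact (abs_add_le _ _).trans (by linarith)
      have := mul_le_mul_of_nonneg_left h1 hT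
      linarith
    have hDb : D ≤ T * |e| + 3 * η * N := by
      have := abs_add_le δ r₂
      linarith
    have hρ : |z 3 - κ * k₁ * z 3 - κ * G.kvα * v z 3| ≤ R * (X + D) := by
      have t1 := abs_sub (z 3 - κ * k₁ * z 3) (κ * G.kvα * v z 3)
      have t2 := abs_sub (z 3) (κ * k₁ * z 3)
      rw [abs_mul] at t1 t2
      have t3 : |κ * G.kvα| * |v z 3| ≤ |κ * G.kvα| * (R₀ * (X + D)) := by gcongr
      have t4 : |z 3| ≤ X + D := by
        have := abs_nonneg (z 0 - xd)
        have := abs_nonneg (z 1)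
        have := abs_nonneg (z 2 - αd)
        linarith
      have t5 : |κ * k₁| * |z 3| ≤ |κ * k₁| * (X + D) := by gcongr
      rw [hR]
      linarith
    have hν₁ : P.Ia * v z 5 = -k * (e + r₃) - d * z 5 := by
      rw [hw5, u₂, hr₃]
      ring
    have hfin := hdecay X e (z 5) _ D r₃ _ hX0 hout' hρ hDb (by linarith) _ hν₁
    have hVd : totalEnergyDeriv P G k c μ h xd αd z (v z) =
        outerEnergyDeriv P.Mt (P.I₀ * P.L) m G.kpx G.kpα c (z 0 - xd) (z 1) (z 2 - αd) (z 3)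
          (z 1) (v z 1) (z 3) (v z 3) + h * innerEnergyDeriv k P.Ia μ e (z 5)
          (z 5 - (z 3 - κ * k₁ * z 3 - κ * G.kvα * v z 3)) (v z 5) := by
      unfold totalEnergyDeriv
      rw [hw0, hw2, hw4]
      congr 3
      ring
    rw [hVd]
    refine hfin.trans ?_
    have h1 := mul_le_mul_of_nonneg_left (hsq1 z) (by positivity : 0 ≤ c₃ / K ^ 2)
    have h4 : c₃ / K ^ 2 * (K ^ 2 * errorSize P G xd αd z ^ 2) = c₃ * N ^ 2 := by
      rw [hNe]
      field_simp
    rw [h4] at h1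
    linarith

end LyapunovFunction

end UAVUGV

end

theorem proposition1 (P : UAVUGV.Plant) (G : UAVUGV.OuterGains) :
    -- asymptotic stability of the equilibrium under the new thrust law
    (∀ xd : ℝ, ∀ αd ∈ Set.Ioo P.αmin P.αmax,
      -- for suitably large inner-loop gains
      (∃ Kv > 0, ∀ kvβ > Kv, ∃ Kp > 0, ∀ kpβ > Kp,
        UAVUGV.AsymptoticallyStable
          (UAVUGV.ClosedLoop P G kpβ kvβ xd αd (UAVUGV.forceNew P G αd))
          (UAVUGV.equilibrium P G xd αd)) ∧
      -- and for all positive inner-loop gains if the desired inclination is not vertical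
      (αd ≠ Real.pi / 2 → ∀ kpβ > 0, ∀ kvβ > 0,
        UAVUGV.AsymptoticallyStable
          (UAVUGV.ClosedLoop P G kpβ kvβ xd αd (UAVUGV.forceNew P G αd))
          (UAVUGV.equilibrium P G xd αd))) ∧
    -- equivalence with the first thrust law preceded by a feed-forward block
    (∃ φ : ℝ → ℝ → ℝ,
      (∀ f e : ℝ, |f| ≤ P.Tmax * P.L →
        |φ f e| ≤ |e| ∧
        UAVUGV.thrustOld P G f * Real.sin (UAVUGV.thetaD P G f + φ f e) =
          UAVUGV.thrustNew P f (UAVUGV.thetaD P G f + e) *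
            Real.sin (UAVUGV.thetaD P G f + e)) ∧
      (∀ (kpβ kvβ xd αd : ℝ) (z w : UAVUGV.State),
        |UAVUGV.tangentialForce P G αd z| ≤ P.Tmax * P.L →
        (UAVUGV.ClosedLoop P G kpβ kvβ xd αd (UAVUGV.forceNew P G αd) z w ↔
          UAVUGV.ClosedLoop P G kpβ kvβ xd αd (UAVUGV.forceOldFF P G φ αd) z w)) ∧
      (∀ xd : ℝ, ∀ αd ∈ Set.Ioo P.αmin P.αmax,
        ∀ᶠ z in nhds (UAVUGV.equilibrium P G xd αd),
          |UAVUGV.tangentialForce P G αd z| ≤ P.Tmax * P.L)) := by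
  refine ⟨fun xd αd hαd => ?_, ?_⟩
  · obtain ⟨a, ha, b, hb, R, hR, hstab⟩ := UAVUGV.exists_stability_constants P G xd hαd
    constructor
    · have hTL := P.Tmax_mul_L_pos.le
      obtain ⟨Kv, hKv, hgain⟩ := UAVUGV.exists_gainCondition (b := b * (P.Tmax * P.L)) (R := R) ha
        (mul_nonneg hR hTL) P.Ia_pos
      refine ⟨Kv, hKv, fun d hd => ?_⟩
      obtain ⟨Kp, hKp, hgain⟩ := hgain d hd
      exact ⟨Kp, hKp, fun k hk => hstab _ hTL
        (UAVUGV.eventually_abs_forceNew_sub_le P G xd hαd) k d (hKv.trans hd) (hgain k hk)⟩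
    · intro hne k hk d hd
      refine hstab 0 le_rfl ?_ k d hd ?_
      · filter_upwards [UAVUGV.eventually_forceNew_eq P G xd hαd hne] with z hz
        rw [hz, sub_self, abs_zero, zero_mul]
      · rw [mul_zero, mul_zero]
        exact UAVUGV.gainCondition_of_decoupled ha P.Ia_pos hk hd
  · have hφ : ∀ f e : ℝ, ∃ ψ : ℝ, |f| ≤ P.Tmax * P.L → |ψ| ≤ |e| ∧
        UAVUGV.thrustOld P G f * Real.sin (UAVUGV.thetaD P G f + ψ) =
          UAVUGV.thrustNew P f (UAVUGV.thetaD P G f + e) *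
            Real.sin (UAVUGV.thetaD P G f + e) := by
      intro f e
      by_cases hf : |f| ≤ P.Tmax * P.L
      · obtain ⟨ψ, hψ⟩ := UAVUGV.exists_feedForward P G e hf
        exact ⟨ψ, fun _ => hψ⟩
      · exact ⟨0, fun h => absurd h hf⟩
    choose φ hφ using hφ
    refine ⟨φ, hφ, fun k d xd αd z w hz => ?_, fun xd αd hαd =>
      (UAVUGV.eventually_abs_tangentialForce_lt P G xd hαd).mono fun _ h => h.le⟩
    have hF : UAVUGV.forceNew P G αd z = UAVUGV.forceOldFF P G φ αd z := by
      have h := (hφ _ (UAVUGV.attError P G αd z) hz).2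
      have hθ : UAVUGV.thetaD P G (UAVUGV.tangentialForce P G αd z) +
          UAVUGV.attError P G αd z = UAVUGV.relAngle z := add_sub_cancel _ _
      rw [hθ] at h
      exact h.symm
    simp only [UAVUGV.ClosedLoop, hF]
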